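/- **Setting.** Let $E\subset\mathbb R^m$ be open, with boundary $\partial E$ and closure $\overline E$, and let $\mathbb U$ and $\widetilde{\mathbb U}$ be Borel spaces (Borel subsets of Polish spaces). Let $\mathbb U(x)\subset\mathbb U$, $x\in\overline E$, be the sets of feasible actions. Let $\phi:\mathbb R^m\times[0,\infty)\to\mathbb R^m$ be a continuous flow: $\phi(x,0)=x$ and $\phi(x,t+s)=\phi(\phi(x,t),s)$. For $x\in E$ put $t_*(x)=\inf\{t>0:\phi(x,t)\in\partial E\}\in[0,\infty]$; if $t_*(x)=\infty$, the symbol $\phi(x,t_*(x))$ means a fixed point $\Delta\in\partial E$. Let $\ell:E\times\mathbb U\times[0,\infty)\to\widetilde{\mathbb U}$ and $\lambda:\overline E\times\widetilde{\mathbb U}\to[0,\infty)$ be measurable, and let $Q$ be a stochastic kernel on $E$ given $(E\times\widetilde{\mathbb U})\cup(\partial E\times\mathbb U)$ with $Q(x,\tilde a;\{x\})=0$ for $x\in E$, $\tilde a\in\widetilde{\mathbb U}$. Write $Qh(x,u)=\int h(y)\,Q(x,u;dy)$, and $Q(x,u;B)$ for the measure of $B$. Let $\mathbb S(x)=\mathbb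 U(x)\times\mathbb U(\phi(x,t_*(x)))$ for $x\in E$, and $\mathcal K=\{(x,a,a_\partial):x\in E,\ (a,a_\partial)\in\mathbb S(x)\}$. Let $\alpha>0$, let $f_i\ge 0$ on $E\times\mathbb U$ and $r_i\ge0$ on $\partial E\times\mathbb U$ be real-valued functions ($i=0,\dots,n$), let $d_1,\dots,d_n\in\mathbb R$, and let $\nu_0$ be a probability measure on $E$. For $x\in E$, $\hat a=(a,a_\partial)\in\mathbb U\times\mathbb U$ and $t\in[0,t_*(x)]$, put $\Lambda^a(x,t)=\int_0^t\lambda(\phi(x,s),\ell(x,a,s))\,ds$ and $$Lg(x,\hat a)=\int_0^{t_*(x)}e^{-\alpha s-\Lambda^a(x,s)}g(\phi(x,s),a)\,ds,\qquad Hg(x,\hat a)=e^{-\alpha t_*(x)-\Lambda^a(x,t_*(x))}g(\phi(x,t_*(x)),a_\partial),$$ $$Gh(x,\hat a)=\int_0^{t_*(x)}e^{-\alpha s-\Lambda^a(x,s)}\lambda(\phi(x,s),\ell(x,a,s))\,Qh(\phi(x,s),\ell(x,a,s))\,ds+e^{-\alpha t_*(x)-\Lambda^a(x,t_*(x))}Qh(\phi(x,t_*(x)),a_\partial)$$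 for nonnegative $g$ and $h$ (the factor $e^{-\alpha t_*(x)-\Lambda^a(x,t_*(x))}$ is $0$ when $t_*(x)=\infty$). Put $G(x,\hat a;B)=G\mathbf 1_B(x,\hat a)$, and extend $L$ and $G$ to signed functions by $Lg=Lg^+-Lg^-$ and $Gh=Gh^+-Gh^-$. A function $g$ on $E$ is regarded as a function on $E\times\mathbb U$ when $L$ is applied to it. Fix $c_0>0$ and let $$w=c_0+Lf_0+Hr_0\ \text{ on }\mathcal K,\qquad w_0(x)=\inf_{\hat a\in\mathbb S(x)}w(x,\hat a).$$ **Control problem.** A strategy is a sequence $U=(\eta_k)_{k\ge0}$ of stochastic kernels on $\mathbb U\times\mathbb U$ given $E$ with $\eta_k(x;\mathbb S(x))=1$ for all $x\in E$. The controlled motion has jump times $0=T_0\le T_1\le\cdots$, post-jump locations $Z_k$ and actions $\Theta_k=(\theta_k,\theta_{k,\partial})$: $Z_0\sim\nu_0$ and $\Theta_0\sim\eta_0(Z_0;\cdot)$; given the past up to the $k$-th jump, with $(Z_k,\Theta_k)=(x,a,a_\partial)$, the sojourn time $S=T_{k+1}-T_k$ satisfies $P(S>t)=e^{-\Lambda^a(x,t)}$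 for $0\le t<t_*(x)$ and $P(S>t)=0$ for $t\ge t_*(x)$; given also $S<\infty$, $Z_{k+1}$ has the distribution $Q(\phi(x,S),\ell(x,a,S);\cdot)$ if $\phi(x,S)\in E$ and $Q(\phi(x,S),a_\partial;\cdot)$ if $\phi(x,S)\in\partial E$, and then $\Theta_{k+1}\sim\eta_{k+1}(Z_{k+1};\cdot)$. Let $X(t)=\phi(Z_k,t-T_k)$ and $N(t)=k$ for $T_k\le t<T_{k+1}$, and $T_\infty=\lim_kT_k$. Put $$\mathcal D_i(U)=E\Big[\int_0^{T_\infty}e^{-\alpha s}f_i(X(s),\theta_{N(s)})\,ds+\sum_{k\ge1:\ T_k<\infty,\ X(T_k-)\in\partial E}e^{-\alpha T_k}r_i(X(T_k-),\theta_{k-1,\partial})\Big].$$ **Problem P.** Let $\mathbf L$ be the set of finite positive measures $\mu$ on $\mathcal K$, with marginal $\widetilde\mu$ on $E$, such that $\int_{\mathcal K}w\,d\mu<\infty$, $$\widetilde\mu(B)-\int_{\mathcal K}G(x,\hat a;B)\,d\mu(x,\hat a)=\nu_0(B)\quad\text{for all Borel }B\subset E,$$ and $\int_{\mathcal K}(Lf_i+Hr_i)\,d\mu\le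 d_i$ for $i=1,\dots,n$. Problem P is to minimize $\int_{\mathcal K}(Lf_0+Hr_0)\,d\mu$ over $\mu\in\mathbf L$. **Theorem.** Assume: 1. $\mathcal K$ is a Borel subset of $E\times\mathbb U\times\mathbb U$, and the functions $f_i$, $r_i$ ($i=0,\dots,n$) are measurable. 2. $\inf\{\mathcal D_0(U):U\text{ a strategy with }\mathcal D_i(U)\le d_i,\ i=1,\dots,n\}<\infty$. 3. There are measurable functions $\overline\lambda:\overline E\to\mathbb R$ and $\underline\lambda:\overline E\to[0,\infty)$ and a constant $K_\lambda\ge0$ such that, for all $x\in E$ and $\tilde a\in\widetilde{\mathbb U}$: $\lambda(x,\tilde a)\le\overline\lambda(x)$; $\int_0^t\overline\lambda(\phi(x,s))\,ds<\infty$ for all $t\in[0,t_*(x))$, and also for $t=t_*(x)$ if $t_*(x)<\infty$; $\lambda(x,\tilde a)\ge\underline\lambda(x)>0$; and $\int_0^{t_*(x)}e^{-\int_0^t\underline\lambda(\phi(x,s))ds}\,dt\le K_\lambda$. 4. The function $w$ is finite and measurable on $\mathcal K$, and $w_0$ is finite and measurable on $E$. There are measurable functions $b,v,\mathcal Xv:E\to\mathbb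 R$ and a number $c>-\alpha$ such that $v\ge0$ and $\sup_Ev/w_0<\infty$; for each $x\in E$, $t\mapsto v(\phi(x,t))$ is locally absolutely continuous on $[0,t_*(x))$ with $v(\phi(x,t))-v(x)=\int_0^t\mathcal Xv(\phi(x,s))\,ds$ for $t\in[0,t_*(x))$, and, if $t_*(x)<\infty$, the limit $v(\phi(x,t_*(x))):=\lim_{t\uparrow t_*(x)}v(\phi(x,t))$ exists in $\mathbb R$; and, for all $(x,a,a_\partial)\in\mathcal K$, $Lb(x,a,a_\partial)$ is well defined and finite, and, for all $t\in[0,t_*(x))$, with $y=\phi(x,t)$ and $u=\ell(x,a,t)$, $$\mathcal Xv(y)+c\,v(y)-\lambda(y,u)\big[v(y)-Qv(y,u)\big]\le b(y),\qquad \lambda(y,u)+\tfrac1{c+\alpha}b(y)\le v(y),$$ and, if $t_*(x)<\infty$, $v(\phi(x,t_*(x)))\ge Qv(\phi(x,t_*(x)),a_\partial)+c+\alpha$; the integrals $Qv$ in these inequalities are finite. 5. The functions $Lf_i+Hr_i$ are lower semicontinuous on $\mathcal K$ for $i=0,\dots,n$. 6. The set $\mathbb S(x)$ is compact for every $x\in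 E$, and the multifunction $x\mapsto\mathbb S(x)$ from $E$ to $\mathbb U\times\mathbb U$ is upper semicontinuous. 7. $Gh$ is bounded and continuous on $\mathcal K$ for every bounded continuous $h:E\to\mathbb R$. Then Problem P is solvable: there is $\mu^*\in\mathbf L$ such that $$\int_{\mathcal K}(Lf_0+Hr_0)\,d\mu^*=\inf_{\mu\in\mathbf L}\int_{\mathcal K}(Lf_0+Hr_0)\,d\mu .$$ -/

import Mathlib

open MeasureTheory ProbabilityTheory Filter Topology Set
open scoped ENNReal NNReal BoundedContinuousFunction

/-- The data of a controlled piecewise deterministic Markov model on an open subset `E` of `ℝᵐ`.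
`U` is the space of actions and `V` the space of parameters of the jump rate and of the
transition measure between the jumps.  Functions that the theory only considers on a part of the
ambient space are total here, and are only required to be measurable on that part. -/
structure PDMPModel (m : ℕ) (U V : Type*) [MeasurableSpace U] [MeasurableSpace V] where
  /-- the state space -/
  E : Set (EuclideanSpace ℝ (Fin m))
  isOpen_E : IsOpen E
  /-- `actions x` is the set of feasible actions at `x`, relevant for `x ∈ closure E` -/
  actions : EuclideanSpace ℝ (Fin m) → Set U
  /-- the flow, relevant for times `t ≥ 0` -/
  flow : EuclideanSpace ℝ (Fin m) → ℝ → EuclideanSpace ℝ (Fin m)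
  flow_continuous :
    ContinuousOn (fun p : EuclideanSpace ℝ (Fin m) × ℝ => flow p.1 p.2) (univ ×ˢ Ici 0)
  flow_zero : ∀ x, flow x 0 = x
  flow_add : ∀ x t s, 0 ≤ t → 0 ≤ s → flow x (t + s) = flow (flow x t) s
  /-- the boundary point that conventionally stands for the exit point of the trajectories that
  never reach the boundary -/
  Δ : EuclideanSpace ℝ (Fin m)
  Δ_mem : Δ ∈ frontier E
  /-- `ell x a t` is the parameter in force `t` units of time after a jump to `x` at which the
  action `a` was selected -/
  ell : E → U → ℝ → V
  ell_measurable : Measurable (fun p : E × U × Ici (0 : ℝ) => ell p.1 p.2.1 p.2.2)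
  /-- the jump rate, on `closure E × V` -/
  rate : EuclideanSpace ℝ (Fin m) → V → ℝ≥0
  rate_measurable : Measurable (fun p : closure E × V => rate p.1 p.2)
  /-- the transition measure for jumps from the interior, on `E × V` -/
  Q : EuclideanSpace ℝ (Fin m) → V → Measure E
  Q_measurable : Measurable (fun p : E × V => Q p.1 p.2)
  Q_prob : ∀ x ∈ E, ∀ u, IsProbabilityMeasure (Q x u)
  Q_self : ∀ (x : E) (u : V), Q x u {x} = 0
  /-- the transition measure for jumps from the boundary, on `frontier E × U` -/
  Qb : EuclideanSpace ℝ (Fin m) → U → Measure E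
  Qb_measurable : Measurable (fun p : frontier E × U => Qb p.1 p.2)
  Qb_prob : ∀ x ∈ frontier E, ∀ a, IsProbabilityMeasure (Qb x a)

namespace PDMPModel

variable {m n : ℕ} {U V : Type*} [MeasurableSpace U] [MeasurableSpace V]

/-- The time `t_*(x) ∈ [0, ∞]` at which the flow started at `x` hits the boundary. -/
noncomputable def exitTime (M : PDMPModel m U V) (x : EuclideanSpace ℝ (Fin m)) : ℝ≥0∞ :=
  ⨅ (t : ℝ) (_ : 0 < t ∧ M.flow x t ∈ frontier M.E), ENNReal.ofReal t

open Classical in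
/-- The exit point `φ(x, t_*(x))`, equal to `Δ` by convention when `t_*(x) = ∞`. -/
noncomputable def exitPoint (M : PDMPModel m U V) (x : EuclideanSpace ℝ (Fin m)) :
    EuclideanSpace ℝ (Fin m) :=
  if M.exitTime x = ∞ then M.Δ else M.flow x (M.exitTime x).toReal

/-- The set of times `[0, τ)`, for `τ ∈ [0, ∞]`. -/
def timesBefore (τ : ℝ≥0∞) : Set ℝ := {s | 0 ≤ s ∧ ENNReal.ofReal s < τ}

/-- The set `𝕊(x) = 𝕌(x) × 𝕌(φ(x, t_*(x)))` of feasible pairs `(a, a_∂)`. -/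
def S (M : PDMPModel m U V) (x : M.E) : Set (U × U) :=
  M.actions x ×ˢ M.actions (M.exitPoint x)

/-- The graph `𝒦` of `x ↦ 𝕊(x)`. -/
def K (M : PDMPModel m U V) : Set (M.E × U × U) := {p | p.2 ∈ M.S p.1}

/-- The cumulated jump rate `Λ^a(x, τ) = ∫_0^τ λ(φ(x,s), ℓ(x,a,s)) ds`. -/
noncomputable def cumRate (M : PDMPModel m U V) (x : M.E) (a : U) (τ : ℝ≥0∞) : ℝ≥0∞ :=
  ∫⁻ s in timesBefore τ, (M.rate (M.flow x s) (M.ell x a s) : ℝ≥0∞)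

/-- The factor `exp (-α τ - Λ^a(x, τ))`, equal to `0` when the exponent is `-∞`. -/
noncomputable def disc (M : PDMPModel m U V) (α : ℝ) (x : M.E) (a : U) (τ : ℝ≥0∞) : ℝ≥0∞ :=
  EReal.exp (-((ENNReal.ofReal α * τ + M.cumRate x a τ : ℝ≥0∞) : EReal))

/-- The operator `L`. -/
noncomputable def opL (M : PDMPModel m U V) (α : ℝ)
    (v : EuclideanSpace ℝ (Fin m) → U → ℝ≥0∞) (p : M.E × U × U) : ℝ≥0∞ :=
  ∫⁻ s in timesBefore (M.exitTime p.1),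
    M.disc α p.1 p.2.1 (ENNReal.ofReal s) * v (M.flow p.1 s) p.2.1

/-- The operator `H`. -/
noncomputable def opH (M : PDMPModel m U V) (α : ℝ)
    (w : EuclideanSpace ℝ (Fin m) → U → ℝ≥0∞) (p : M.E × U × U) : ℝ≥0∞ :=
  M.disc α p.1 p.2.1 (M.exitTime p.1) * w (M.exitPoint p.1) p.2.2

/-- The integral `Gh(x, a, a_∂) = ∫ h(y) G(x, a, a_∂; dy)` of a nonnegative function `h` against
the kernel `G`. -/
noncomputable def opG (M : PDMPModel m U V) (α : ℝ) (h : M.E → ℝ≥0∞) (p : M.E × U × U) : ℝ≥0∞ :=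
  (∫⁻ s in timesBefore (M.exitTime p.1),
    M.disc α p.1 p.2.1 (ENNReal.ofReal s) * M.rate (M.flow p.1 s) (M.ell p.1 p.2.1 s) *
      ∫⁻ y, h y ∂(M.Q (M.flow p.1 s) (M.ell p.1 p.2.1 s))) +
  M.disc α p.1 p.2.1 (M.exitTime p.1) * ∫⁻ y, h y ∂(M.Qb (M.exitPoint p.1) p.2.2)

/-- The kernel `G(x, a, a_∂; B)`. -/
noncomputable def kerG (M : PDMPModel m U V) (α : ℝ) (p : M.E × U × U) (B : Set M.E) : ℝ≥0∞ :=
  M.opG α (B.indicator 1) p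

/-- `Gh = Gh⁺ - Gh⁻` for a real function `h`. -/
noncomputable def opGReal (M : PDMPModel m U V) (α : ℝ) (h : M.E → ℝ) (p : M.E × U × U) : ℝ :=
  (M.opG α (fun y => ENNReal.ofReal (h y)) p).toReal -
    (M.opG α (fun y => ENNReal.ofReal (-h y)) p).toReal

/-- The one-stage cost `Lf + Hr`. -/
noncomputable def stageCost (M : PDMPModel m U V) (α : ℝ)
    (f r : EuclideanSpace ℝ (Fin m) → U → ℝ≥0) (p : M.E × U × U) : ℝ≥0∞ :=
  M.opL α (fun x a => (f x a : ℝ≥0∞)) p + M.opH α (fun x a => (r x a : ℝ≥0∞)) p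

/-! ### Strategies, the law of the controlled motion, and its costs -/

/-- An admissible randomized strategy: a sequence of stochastic kernels `η_k` on `U × U` given `E`
such that `η_k(x; ·)` is concentrated on `𝕊(x)`. -/
def IsStrategy (M : PDMPModel m U V) (η : ℕ → Kernel M.E (U × U)) : Prop :=
  ∀ k, IsMarkovKernel (η k) ∧ ∀ x, η k x (M.S x)ᶜ = 0

/-- A path of the controlled motion, coded by its marked jumps: `ω k = ((Z_k, Θ_k), S_{k+1})`,
where `Z_k` is the location after the `k`-th jump, `Θ_k = (θ_k, θ_{k,∂})` the pair of actions
selected there, and `S_{k+1} = T_{k+1} - T_k ∈ [0, ∞]` the time until the next jump.  The marks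
after a sojourn of infinite length are meaningless. -/
abbrev Path (M : PDMPModel m U V) : Type _ := ℕ → (M.E × U × U) × ℝ≥0∞

/-- The jump time `T_k`. -/
noncomputable def jumpTime (M : PDMPModel m U V) (ω : M.Path) (k : ℕ) : ℝ≥0∞ :=
  ∑ i ∈ Finset.range k, (ω i).2

/-- The limit `T_∞` of the jump times. -/
noncomputable def jumpTimeLim (M : PDMPModel m U V) (ω : M.Path) : ℝ≥0∞ := ⨆ k, M.jumpTime ω k

/-- The number `N(t)` of jumps up to time `t`. -/
noncomputable def jumpCount (M : PDMPModel m U V) (ω : M.Path) (t : ℝ) : ℕ :=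
  {k : ℕ | M.jumpTime ω (k + 1) ≤ ENNReal.ofReal t}.ncard

/-- The position `X(t)`, for `0 ≤ t < T_∞`: the motion follows the flow between the jumps. -/
noncomputable def position (M : PDMPModel m U V) (ω : M.Path) (t : ℝ) :
    EuclideanSpace ℝ (Fin m) :=
  M.flow (ω (M.jumpCount ω t)).1.1 (t - (M.jumpTime ω (M.jumpCount ω t)).toReal)

/-- The position `X(T_{k+1}-)` immediately before the jump at `T_{k+1} < ∞`. -/
def positionBefore (M : PDMPModel m U V) (ω : M.Path) (k : ℕ) : EuclideanSpace ℝ (Fin m) :=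
  M.flow (ω k).1.1 (ω k).2.toReal

open Classical in
/-- The discounted cost of a path up to `T_∞`: the integral over `[0, T_∞)` of
`exp (-α s) f(X(s), θ_{N(s)})`, plus the sum of `exp (-α T) r(X(T-), θ_{N(T-),∂})` over the finite
jump times `T` for which `X(T-)` lies on the boundary. -/
noncomputable def pathCost (M : PDMPModel m U V) (α : ℝ)
    (f r : EuclideanSpace ℝ (Fin m) → U → ℝ≥0) (ω : M.Path) : ℝ≥0∞ :=
  (∫⁻ s in timesBefore (M.jumpTimeLim ω),
    ENNReal.ofReal (Real.exp (-α * s)) * f (M.position ω s) (ω (M.jumpCount ω s)).1.2.1) +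
  ∑' k : ℕ, if M.jumpTime ω (k + 1) < ∞ ∧ M.positionBefore ω k ∈ frontier M.E then
    ENNReal.ofReal (Real.exp (-α * (M.jumpTime ω (k + 1)).toReal)) *
      r (M.positionBefore ω k) (ω k).1.2.2 else 0

/-- The information `σ(Z_0, Θ_0, S_1, …, S_k, Z_k, Θ_k)`. -/
@[reducible] def infoAfterJump (M : PDMPModel m U V) (k : ℕ) : MeasurableSpace M.Path :=
  MeasurableSpace.comap (fun ω : M.Path => ((fun i : Fin k => ω i), (ω k).1)) inferInstance

/-- The information `σ(Z_0, Θ_0, S_1, …, Z_k, Θ_k, S_{k+1})`. -/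
@[reducible] def infoBeforeJump (M : PDMPModel m U V) (k : ℕ) : MeasurableSpace M.Path :=
  MeasurableSpace.comap (fun ω : M.Path => fun i : Fin (k + 1) => ω i) inferInstance

open Classical in
/-- The probability `P(T_1 > t)` for the motion started at `x` with the action `a`:
`exp (-Λ^a(x, t))` for `t < t_*(x)`, and `0` for `t ≥ t_*(x)`. -/
noncomputable def survival (M : PDMPModel m U V) (x : M.E) (a : U) (t : ℝ) : ℝ≥0∞ :=
  if ENNReal.ofReal t < M.exitTime x then
    EReal.exp (-((M.cumRate x a (ENNReal.ofReal t) : ℝ≥0∞) : EReal)) else 0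

open Classical in
/-- The distribution of the location after a jump that takes place `s` units of time after a jump
to `x` at which the actions `(a, a_∂)` were selected. -/
noncomputable def postJump (M : PDMPModel m U V) (p : M.E × U × U) (s : ℝ) : Measure M.E :=
  if M.flow p.1 s ∈ M.E then M.Q (M.flow p.1 s) (M.ell p.1 p.2.1 s)
  else M.Qb (M.flow p.1 s) p.2.2

/-- `P` is the law of the motion controlled by the strategy `η` and started from `ν₀`. -/
structure IsControlledLaw (M : PDMPModel m U V) (η : ℕ → Kernel M.E (U × U)) (ν₀ : Measure M.E)
    (P : Measure M.Path) : Prop where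
  isProb : IsProbabilityMeasure P
  /-- `Z_0` has the law `ν₀`, and `Θ_0` is selected by `η_0(Z_0; ·)` -/
  initial : ∀ C : Set (M.E × U × U), MeasurableSet C →
    P {ω | (ω 0).1 ∈ C} = ∫⁻ x, η 0 x {c | (x, c) ∈ C} ∂ν₀
  /-- on `T_k < ∞`, the conditional probability of `S_{k+1} > t` given the information available
  after the `k`-th jump is the survival function -/
  sojourn : ∀ (k : ℕ) (t : ℝ), 0 ≤ t → ∀ A : Set M.Path, MeasurableSet[M.infoAfterJump k] A →
    P (A ∩ {ω | M.jumpTime ω k < ∞} ∩ {ω | ENNReal.ofReal t < (ω k).2}) =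
      ∫⁻ ω in A ∩ {ω | M.jumpTime ω k < ∞}, M.survival (ω k).1.1 (ω k).1.2.1 t ∂P
  /-- on `T_{k+1} < ∞`, given the information available before the `k + 1`-st jump, `Z_{k+1}` is
  selected by the transition measure and then `Θ_{k+1}` by `η_{k+1}(Z_{k+1}; ·)` -/
  jump : ∀ (k : ℕ) (C : Set (M.E × U × U)), MeasurableSet C →
    ∀ A : Set M.Path, MeasurableSet[M.infoBeforeJump k] A →
    P (A ∩ {ω | M.jumpTime ω (k + 1) < ∞} ∩ {ω | (ω (k + 1)).1 ∈ C}) =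
      ∫⁻ ω in A ∩ {ω | M.jumpTime ω (k + 1) < ∞},
        (∫⁻ y, η (k + 1) y {c | (y, c) ∈ C} ∂(M.postJump (ω k).1 (ω k).2.toReal)) ∂P

/-- The expected discounted cost under the law `P`. -/
noncomputable def discountedCost (M : PDMPModel m U V) (α : ℝ)
    (f r : EuclideanSpace ℝ (Fin m) → U → ℝ≥0) (P : Measure M.Path) : ℝ≥0∞ :=
  ∫⁻ ω, M.pathCost α f r ω ∂P

/-- The value of the constrained discounted control problem: the infimum of the cost of index `0`
over the admissible strategies for which the cost of index `i` is at most `d_i`,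
for `i = 1, …, n`. -/
noncomputable def constrainedValue (M : PDMPModel m U V) (α : ℝ)
    (f r : Fin (n + 1) → EuclideanSpace ℝ (Fin m) → U → ℝ≥0) (d : Fin n → ℝ)
    (ν₀ : Measure M.E) : ℝ≥0∞ :=
  ⨅ (η : ℕ → Kernel M.E (U × U)) (_ : M.IsStrategy η)
    (P : Measure M.Path) (_ : M.IsControlledLaw η ν₀ P)
    (_ : ∀ i : Fin n, (M.discountedCost α (f i.succ) (r i.succ) P : EReal) ≤ (d i : EReal)),
    M.discountedCost α (f 0) (r 0) P

/-! ### The linear program -/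

/-- `w = c₀ + L f₀ + H r₀`. -/
noncomputable def weight (M : PDMPModel m U V) (α c₀ : ℝ)
    (f₀ r₀ : EuclideanSpace ℝ (Fin m) → U → ℝ≥0) (p : M.E × U × U) : ℝ≥0∞ :=
  ENNReal.ofReal c₀ + M.stageCost α f₀ r₀ p

/-- `w₀(x) = inf_{𝕊(x)} w(x, ·)`. -/
noncomputable def weightInf (M : PDMPModel m U V) (α c₀ : ℝ)
    (f₀ r₀ : EuclideanSpace ℝ (Fin m) → U → ℝ≥0) (x : M.E) : ℝ≥0∞ :=
  ⨅ c ∈ M.S x, M.weight α c₀ f₀ r₀ (x, c)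

/-- The feasible set of the linear program: finite measures `μ` on `𝒦` (as measures on `E × U × U`
that do not charge the complement of `𝒦`) with `∫ w dμ < ∞`, such that
`μ(B × U × U) = ν₀(B) + ∫ G(·; B) dμ` for all Borel subsets `B` of `E`, and
`∫ (L f_i + H r_i) dμ ≤ d_i` for `i = 1, …, n`. -/
structure IsFeasible (M : PDMPModel m U V) (α c₀ : ℝ)
    (f r : Fin (n + 1) → EuclideanSpace ℝ (Fin m) → U → ℝ≥0) (d : Fin n → ℝ)
    (ν₀ : Measure M.E) (μ : Measure (M.E × U × U)) : Prop where
  finite : IsFiniteMeasure μ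
  support : μ (M.K)ᶜ = 0
  weight_lt_top : ∫⁻ p, M.weight α c₀ (f 0) (r 0) p ∂μ < ∞
  balance : ∀ B : Set M.E, MeasurableSet B →
    μ.map Prod.fst B = ν₀ B + ∫⁻ p, M.kerG α p B ∂μ
  constraint : ∀ i : Fin n,
    ((∫⁻ p, M.stageCost α (f i.succ) (r i.succ) p ∂μ : ℝ≥0∞) : EReal) ≤ (d i : EReal)

/-! ### The assumptions -/

/-- `f_i` is measurable on `E × U` and `r_i` is measurable on `∂E × U`. -/
def MeasurableCosts (M : PDMPModel m U V)
    (f r : Fin (n + 1) → EuclideanSpace ℝ (Fin m) → U → ℝ≥0) : Prop :=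
  ∀ i, Measurable (fun p : M.E × U => f i p.1 p.2) ∧
    Measurable (fun p : frontier M.E × U => r i p.1 p.2)

/-- Upper and lower bounds `hi` and `lo` on the jump rate. -/
def RateBounds (M : PDMPModel m U V) : Prop :=
  ∃ (hi : EuclideanSpace ℝ (Fin m) → ℝ) (lo : EuclideanSpace ℝ (Fin m) → ℝ≥0) (Kl : ℝ≥0),
    Measurable (fun x : closure M.E => hi x) ∧ Measurable (fun x : closure M.E => lo x) ∧
    (∀ x ∈ M.E, ∀ u : V, (M.rate x u : ℝ) ≤ hi x ∧ lo x ≤ M.rate x u) ∧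
    (∀ x ∈ M.E, 0 < lo x) ∧
    (∀ x ∈ M.E, ∀ τ : ℝ≥0∞, τ ≤ M.exitTime x → τ < ∞ →
      ∫⁻ s in timesBefore τ, ENNReal.ofReal (hi (M.flow x s)) < ∞) ∧
    (∀ x ∈ M.E,
      ∫⁻ t in timesBefore (M.exitTime x),
        EReal.exp (-((∫⁻ s in timesBefore (ENNReal.ofReal t), (lo (M.flow x s) : ℝ≥0∞) : ℝ≥0∞)
          : EReal)) ≤ Kl)

/-- `v` is measurable on `E`, locally absolutely continuous along the flow on `[0, t_*(x))`, and has
a limit along the flow at `t_*(x)` when `t_*(x) < ∞`. -/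
def ACAlongFlow (M : PDMPModel m U V) (v : EuclideanSpace ℝ (Fin m) → ℝ) : Prop :=
  Measurable (fun x : M.E => v x) ∧
  (∀ x ∈ M.E, ∀ t ∈ timesBefore (M.exitTime x),
    AbsolutelyContinuousOnInterval (fun s => v (M.flow x s)) 0 t) ∧
  (∀ x ∈ M.E, M.exitTime x < ∞ →
    ∃ l : ℝ, Tendsto (fun s => v (M.flow x s)) (𝓝[<] (M.exitTime x).toReal) (𝓝 l))

/-- `Xv` is a derivative `𝒳v` of `v` along the flow. -/
def IsFlowDerivative (M : PDMPModel m U V) (v Xv : EuclideanSpace ℝ (Fin m) → ℝ) : Prop :=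
  Measurable (fun x : M.E => Xv x) ∧
  ∀ x ∈ M.E, ∀ t ∈ timesBefore (M.exitTime x),
    IntervalIntegrable (fun s => Xv (M.flow x s)) volume 0 t ∧
    v (M.flow x t) - v x = ∫ s in (0 : ℝ)..t, Xv (M.flow x s)

/-- The weights are finite and measurable, and there is a nonnegative function `v` on `E` that
satisfies the growth condition.  In the boundary inequality, the value of `v` at the exit point of
the trajectory of `x` is its limit along that trajectory. -/
def GrowthCondition (M : PDMPModel m U V) (α c₀ : ℝ)
    (f₀ r₀ : EuclideanSpace ℝ (Fin m) → U → ℝ≥0) : Prop :=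
  (∀ p ∈ M.K, M.weight α c₀ f₀ r₀ p < ∞) ∧
  Measurable (fun p : M.K => M.weight α c₀ f₀ r₀ p) ∧
  (∀ x, M.weightInf α c₀ f₀ r₀ x < ∞) ∧
  Measurable (M.weightInf α c₀ f₀ r₀) ∧
  ∃ (b v Xv : EuclideanSpace ℝ (Fin m) → ℝ) (c : ℝ),
    Measurable (fun x : M.E => b x) ∧ -α < c ∧
    M.ACAlongFlow v ∧ M.IsFlowDerivative v Xv ∧
    (∀ x ∈ M.E, 0 ≤ v x) ∧
    (∃ C : ℝ≥0, ∀ x : M.E, ENNReal.ofReal (v x) ≤ C * M.weightInf α c₀ f₀ r₀ x) ∧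
    (∀ p ∈ M.K, M.opL α (fun x _ => ENNReal.ofReal (b x)) p < ∞ ∧
      M.opL α (fun x _ => ENNReal.ofReal (-b x)) p < ∞) ∧
    (∀ p ∈ M.K, ∀ t ∈ timesBefore (M.exitTime p.1),
      Integrable (fun y : M.E => v y) (M.Q (M.flow p.1 t) (M.ell p.1 p.2.1 t)) ∧
      Xv (M.flow p.1 t) + c * v (M.flow p.1 t) -
        M.rate (M.flow p.1 t) (M.ell p.1 p.2.1 t) *
          (v (M.flow p.1 t) - ∫ y : M.E, v y ∂(M.Q (M.flow p.1 t) (M.ell p.1 p.2.1 t)))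
        ≤ b (M.flow p.1 t) ∧
      (M.rate (M.flow p.1 t) (M.ell p.1 p.2.1 t) : ℝ) + 1 / (c + α) * b (M.flow p.1 t)
        ≤ v (M.flow p.1 t)) ∧
    (∀ p ∈ M.K, M.exitTime p.1 < ∞ →
      Integrable (fun y : M.E => v y) (M.Qb (M.exitPoint p.1) p.2.2) ∧
      ∀ l : ℝ, Tendsto (fun s => v (M.flow p.1 s)) (𝓝[<] (M.exitTime p.1).toReal) (𝓝 l) →
        (∫ y : M.E, v y ∂(M.Qb (M.exitPoint p.1) p.2.2)) + (c + α) ≤ l)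

/-- `Gh` is bounded and continuous on `𝒦` for every bounded continuous `h` on `E`. -/
def WeaklyContinuousG [TopologicalSpace U] (M : PDMPModel m U V) (α : ℝ) : Prop :=
  ∀ h : M.E →ᵇ ℝ, ContinuousOn (M.opGReal α h) M.K ∧ ∃ C : ℝ, ∀ p ∈ M.K, |M.opGReal α h p| ≤ C

end PDMPModel

/-! Existence of an optimal solution of the linear program of a constrained discounted control
problem for piecewise deterministic Markov processes.

The infimum is finite and the feasible set is not empty, because the discounted occupation measure
of an admissible motion of finite cost is feasible (`exists_isFeasible`).  The point is to pass to
the limit in a minimizing sequence.  Tightness of the feasible measures themselves would need a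
uniform control of the late stages of the motion.  The proof avoids this question: it works with
the *sequence* of the discounted laws `μ k` of the states and actions after the `k`-th jump instead
of with their sum (`IsOccupationSequence`): the state marginal of `μ 0` is `ν₀`, and that of
`μ (k + 1)` is `∫ G(p; ·) dμ k`.

* Every feasible measure dominates the sum of such a sequence, the one of the stationary randomized
  strategy obtained by disintegration (`IsFeasible.exists_isOccupationSequence`); since the costs
  are nonnegative, nothing is lost by passing to that sum.
* Conversely, the sum of such a sequence is feasible as soon as its costs are admissible
  (`IsOccupationSequence.isFeasible_sum`).  The balance equation is immediate; finiteness comes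
  from the growth condition.  Integrating it along the flow gives a Lyapunov inequality
  `G(v + κ) ≤ v` on `𝒦` with `κ > 0` (`GrowthCondition.exists_lyapunov`), so that `∫ v dμ k`
  decreases by at least `κ` times the mass of `μ (k + 1)` at each step, starting from a finite value
  because `v` is dominated by the weight.
* For fixed `k` the measures `μ k` are tight, uniformly over all such sequences
  (`exists_forall_isOccupationSequence_compl_le`), by induction on `k`: the part of
  `𝒦` over a compact set of states is compact, and there the kernel `G` is uniformly tight by Dini's
  argument, since `G h` is continuous for bounded continuous `h`.  The limits of the terms along an
  ultrafilter again form an occupation sequence, and the costs are lower semicontinuous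
  (`exists_isOccupationSequence_limit`).

Applied to a minimizing sequence, the last item yields an occupation sequence whose sum satisfies
the constraints and has a cost at most the infimum; by the second item it is feasible.

The kernel `G` is handled through the law of the sojourn time (`sojournLaw`) and the distribution
of the location after the jump (`landing`): `G h` is the mean of the discounted value of `h` after
the jump, and the one-stage cost is the mean cost of a sojourn.  This also identifies the occupation
measures of a controlled motion with an occupation sequence. -/

/-! ### The exponential of a nonpositive extended number -/

/-- The number `exp (-a) ∈ [0, 1]`, for `a ∈ [0, ∞]`. -/
noncomputable def expNeg (a : ℝ≥0∞) : ℝ≥0∞ := EReal.exp (-(a : EReal))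

lemma expNeg_eq_inv (a : ℝ≥0∞) : expNeg a = (EReal.exp a)⁻¹ := EReal.exp_neg _

@[simp] lemma expNeg_zero : expNeg 0 = 1 := by simp [expNeg]

@[simp] lemma expNeg_top : expNeg ∞ = 0 := by simp [expNeg]

lemma expNeg_add (a b : ℝ≥0∞) : expNeg (a + b) = expNeg a * expNeg b := by
  rcases eq_or_ne a ∞ with rfl | ha
  · simp
  rcases eq_or_ne b ∞ with rfl | hb
  · simp
  rw [expNeg_eq_inv, EReal.coe_ennreal_add, EReal.exp_add, expNeg_eq_inv, expNeg_eq_inv,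
    ENNReal.mul_inv]
  · right; simpa using hb
  · left; simpa using ha

lemma expNeg_ofReal {x : ℝ} (hx : 0 ≤ x) :
    expNeg (ENNReal.ofReal x) = ENNReal.ofReal (Real.exp (-x)) := by
  rw [expNeg, EReal.coe_ennreal_ofReal, max_eq_left hx, ← EReal.coe_neg, EReal.exp_coe]

lemma expNeg_le_one (a : ℝ≥0∞) : expNeg a ≤ 1 := by
  simp [expNeg, EReal.exp_le_one_iff, EReal.coe_ennreal_nonneg]

lemma expNeg_ne_top (a : ℝ≥0∞) : expNeg a ≠ ∞ :=
  ((expNeg_le_one a).trans_lt ENNReal.one_lt_top).ne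

lemma continuous_expNeg : Continuous expNeg :=
  ENNReal.continuous_exp.comp (continuous_neg.comp continuous_coe_ennreal_ereal)

lemma measurable_expNeg : Measurable expNeg := continuous_expNeg.measurable

namespace PDMPModel

variable {m n : ℕ} {U V : Type*} [MeasurableSpace U] [MeasurableSpace V]

/-! ### The intervals `[0, τ)` -/

lemma measurableSet_timesBefore (τ : ℝ≥0∞) : MeasurableSet (timesBefore τ) :=
  measurableSet_Ici.inter (measurableSet_lt ENNReal.measurable_ofReal measurable_const)

lemma timesBefore_mono {σ τ : ℝ≥0∞} (h : σ ≤ τ) : timesBefore σ ⊆ timesBefore τ :=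
  fun _ hs => ⟨hs.1, hs.2.trans_le h⟩

lemma timesBefore_ofReal (t : ℝ) : timesBefore (ENNReal.ofReal t) = Ico 0 t := by
  ext s
  simp only [timesBefore, mem_ofPred_eq, mem_Ico, ENNReal.ofReal_lt_ofReal_iff']
  constructor
  · rintro ⟨h, h', -⟩; exact ⟨h, h'⟩
  · rintro ⟨h, h'⟩; exact ⟨h, h', h.trans_lt h'⟩

/-- The integral over `[0, τ)` depends continuously on `τ` along sequences from below. -/
lemma tendsto_lintegral_timesBefore (g : ℝ → ℝ≥0∞) {τ : ℝ≥0∞} {u : ℕ → ℝ≥0∞} (hu : Monotone u)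
    (hut : Tendsto u atTop (𝓝 τ)) :
    Tendsto (fun k => ∫⁻ s in timesBefore (u k), g s) atTop
      (𝓝 (∫⁻ s in timesBefore τ, g s)) := by
  have hunion : timesBefore τ = ⋃ k, timesBefore (u k) := by
    ext s
    simp only [mem_iUnion]
    constructor
    · rintro ⟨h0, h⟩
      obtain ⟨k, hk⟩ := ((tendsto_order.1 hut).1 _ h).exists
      exact ⟨k, h0, hk⟩
    · rintro ⟨k, hk⟩
      exact timesBefore_mono (hu.ge_of_tendsto hut k) hk
  have key := tendsto_measure_iUnion_atTop (μ := volume.withDensity g)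
    (s := fun k => timesBefore (u k)) (fun i j hij => timesBefore_mono (hu hij))
  rw [← hunion] at key
  simpa only [Function.comp_def, withDensity_apply _ (measurableSet_timesBefore _)] using key

variable (M : PDMPModel m U V)

/-! ### The flow and the exit time -/

lemma continuousOn_flow (x : EuclideanSpace ℝ (Fin m)) : ContinuousOn (M.flow x) (Ici 0) :=
  M.flow_continuous.comp (f := fun t : ℝ => (x, t)) (by fun_prop) (fun _ ht => ⟨mem_univ _, ht⟩)

lemma continuous_flow_max :
    Continuous (fun p : EuclideanSpace ℝ (Fin m) × ℝ => M.flow p.1 (max p.2 0)) :=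
  M.flow_continuous.comp_continuous (f := fun p : EuclideanSpace ℝ (Fin m) × ℝ =>
    (p.1, max p.2 0)) (by fun_prop) (fun p => ⟨mem_univ _, le_max_right p.2 0⟩)

/-- The trajectory stays in `E` before the exit time. -/
lemma flow_mem_of_mem_timesBefore {x : EuclideanSpace ℝ (Fin m)} (hx : x ∈ M.E) {s : ℝ}
    (hs : s ∈ timesBefore (M.exitTime x)) : M.flow x s ∈ M.E := by
  obtain ⟨h0, hs⟩ := hs
  have hpre : IsPreconnected (M.flow x '' Icc 0 s) :=
    isPreconnected_Icc.image _ ((M.continuousOn_flow x).mono fun t ht => ht.1)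
  refine hpre.subset_of_closure_inter_subset M.isOpen_E
    ⟨x, ⟨0, ⟨le_rfl, h0⟩, M.flow_zero x⟩, hx⟩ ?_ ⟨s, ⟨h0, le_rfl⟩, rfl⟩
  rintro _ ⟨hcl, t, ht, rfl⟩
  by_contra hnot
  have hfr : M.flow x t ∈ frontier M.E := by
    rw [M.isOpen_E.frontier_eq]; exact ⟨hcl, hnot⟩
  have htpos : 0 < t := by
    rcases ht.1.eq_or_lt with h | h
    · rw [← h, M.flow_zero] at hnot; exact absurd hx hnot
    · exact h
  have : M.exitTime x ≤ ENNReal.ofReal t := iInf₂_le t ⟨htpos, hfr⟩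
  exact (this.trans (ENNReal.ofReal_le_ofReal ht.2)).not_gt hs

/-- The exit time is attained: for a trajectory from `E`, the exit time is at most `T` exactly if
the trajectory meets the boundary in `[0, T]`. -/
lemma exitTime_le_ofReal_iff {x : EuclideanSpace ℝ (Fin m)} (hx : x ∈ M.E) {T : ℝ} :
    M.exitTime x ≤ ENNReal.ofReal T ↔ ∃ t ∈ Icc 0 T, M.flow x t ∈ frontier M.E := by
  constructor
  · intro h
    by_contra! hno
    rcases lt_or_ge T 0 with hT | hT
    · rw [ENNReal.ofReal_of_nonpos hT.le, nonpos_iff_eq_zero] at h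
      -- near time `0` the trajectory is in the open set `E`
      have hev : ∀ᶠ t in 𝓝[≥] (0 : ℝ), M.flow x t ∈ M.E := by
        have := (M.continuousOn_flow x) 0 self_mem_Ici
        exact this (by rw [M.flow_zero]; exact M.isOpen_E.mem_nhds hx)
      obtain ⟨δ, hδ, hsub⟩ := mem_nhdsGE_iff_exists_Ico_subset.1 hev
      have : ENNReal.ofReal δ ≤ M.exitTime x := by
        refine le_iInf₂ fun t ht => ENNReal.ofReal_le_ofReal ?_
        by_contra! hlt
        exact (disjoint_frontier_iff_isOpen.2 M.isOpen_E).ne_of_mem ht.2 (hsub ⟨ht.1.le, hlt⟩) rfl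
      rw [h, nonpos_iff_eq_zero, ENNReal.ofReal_eq_zero] at this
      exact absurd this (not_le.2 hδ)
    · -- the trajectory stays off the closed boundary for a while after `T`
      have hTE : M.flow x T ∈ (frontier M.E)ᶜ := hno T ⟨hT, le_rfl⟩
      have hev : ∀ᶠ t in 𝓝[≥] T, M.flow x t ∈ (frontier M.E)ᶜ := by
        have h1 : ContinuousWithinAt (M.flow x) (Ici T) T :=
          ((M.continuousOn_flow x) T hT).mono (Ici_subset_Ici.2 hT)
        exact h1 (isClosed_frontier.isOpen_compl.mem_nhds hTE)
      obtain ⟨δ, hδ, hsub⟩ := mem_nhdsGE_iff_exists_Ico_subset.1 hev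
      have h2 : ENNReal.ofReal δ ≤ M.exitTime x := by
        refine le_iInf₂ fun t ht => ENNReal.ofReal_le_ofReal ?_
        by_contra! hlt
        rcases le_or_gt t T with htT | htT
        · exact hno t ⟨ht.1.le, htT⟩ ht.2
        · exact hsub ⟨htT.le, hlt⟩ ht.2
      have h3 := h2.trans h
      rw [ENNReal.ofReal_le_ofReal_iff hT] at h3
      exact absurd h3 (not_le.2 hδ)
  · rintro ⟨t, ht, hfr⟩
    have htpos : 0 < t := by
      rcases ht.1.eq_or_lt with h | h
      · rw [← h, M.flow_zero] at hfr
        exact absurd hx (fun hx' =>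
          (disjoint_frontier_iff_isOpen.2 M.isOpen_E).ne_of_mem hfr hx' rfl)
      · exact h
    exact (iInf₂_le t ⟨htpos, hfr⟩ : M.exitTime x ≤ _).trans (ENNReal.ofReal_le_ofReal ht.2)

lemma exitTime_pos {x : EuclideanSpace ℝ (Fin m)} (hx : x ∈ M.E) : 0 < M.exitTime x := by
  by_contra! h
  rw [← ENNReal.ofReal_zero, M.exitTime_le_ofReal_iff hx] at h
  obtain ⟨t, ht, hfr⟩ := h
  have : t = 0 := by simpa using ht
  rw [this, M.flow_zero] at hfr
  exact (disjoint_frontier_iff_isOpen.2 M.isOpen_E).ne_of_mem hfr hx rfl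

lemma exitPoint_mem_frontier {x : EuclideanSpace ℝ (Fin m)} (hx : x ∈ M.E) :
    M.exitPoint x ∈ frontier M.E := by
  unfold exitPoint
  split_ifs with h
  · exact M.Δ_mem
  · obtain ⟨t, ht, hfr⟩ := (M.exitTime_le_ofReal_iff hx).1 (ENNReal.ofReal_toReal h).ge
    have h1 : M.exitTime x ≤ ENNReal.ofReal t :=
      (M.exitTime_le_ofReal_iff hx).2 ⟨t, ⟨ht.1, le_rfl⟩, hfr⟩
    have h2 := ENNReal.toReal_mono ENNReal.ofReal_ne_top h1
    rw [ENNReal.toReal_ofReal ht.1] at h2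
    rwa [← le_antisymm ht.2 h2]

lemma measurable_exitTime : Measurable (fun x : M.E => M.exitTime x) := by
  refine LowerSemicontinuous.measurable (lowerSemicontinuous_iff_isClosed_preimage.2 fun τ => ?_)
  rcases eq_or_ne τ ∞ with rfl | hτ
  · simp
  -- the sublevel sets are projections along a compact interval of times
  have hcl : IsClosed {q : M.E × Icc 0 τ.toReal | M.flow q.1 q.2 ∈ frontier M.E} := by
    refine isClosed_frontier.preimage ?_
    exact M.flow_continuous.comp_continuous (f := fun q : M.E × Icc 0 τ.toReal =>
      ((q.1 : EuclideanSpace ℝ (Fin m)), (q.2 : ℝ))) (by fun_prop) (fun q => ⟨mem_univ _, q.2.2.1⟩)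
  have := isClosedMap_fst_of_compactSpace (X := M.E) (Y := Icc 0 τ.toReal) _ hcl
  convert this using 1
  ext x
  rw [mem_preimage, mem_Iic, ← ENNReal.ofReal_toReal hτ, M.exitTime_le_ofReal_iff x.2,
    ENNReal.ofReal_toReal hτ]
  constructor
  · rintro ⟨t, ht, h⟩; exact ⟨(x, ⟨t, ht⟩), h, rfl⟩
  · rintro ⟨⟨y, t⟩, h, rfl⟩; exact ⟨t, t.2, h⟩

lemma measurable_exitPoint : Measurable (fun x : M.E => M.exitPoint x) := by
  unfold exitPoint
  refine Measurable.ite (M.measurable_exitTime (measurableSet_singleton _)) measurable_const ?_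
  have : (fun x : M.E => M.flow x (M.exitTime x).toReal) =
      fun x : M.E => M.flow x (max (M.exitTime x).toReal 0) := by
    ext1 x; rw [max_eq_left ENNReal.toReal_nonneg]
  rw [this]
  exact M.continuous_flow_max.measurable.comp
    (measurable_subtype_coe.prodMk M.measurable_exitTime.ennreal_toReal)

/-! ### Measurability along the trajectories -/

/-- The pairs of a starting configuration and a time before the exit. -/
def preExit : Set ((M.E × U × U) × ℝ) := {q | q.2 ∈ timesBefore (M.exitTime q.1.1)}

lemma measurableSet_preExit : MeasurableSet M.preExit := by
  have h1 : Measurable fun q : (M.E × U × U) × ℝ => M.exitTime q.1.1 :=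
    M.measurable_exitTime.comp (measurable_fst.comp measurable_fst)
  exact (measurableSet_le measurable_const measurable_snd).inter
    (measurableSet_lt (ENNReal.measurable_ofReal.comp measurable_snd) h1)

/-- The state and the parameter in force at a time before the exit. -/
def preExitPoint (q : M.preExit) : M.E × V :=
  (⟨M.flow q.1.1.1 q.1.2, M.flow_mem_of_mem_timesBefore q.1.1.1.2 q.2⟩,
    M.ell q.1.1.1 q.1.1.2.1 q.1.2)

lemma measurable_preExitPoint : Measurable M.preExitPoint := by
  refine Measurable.prodMk (Measurable.subtype_mk ?_) ?_
  · have : (fun q : M.preExit => M.flow q.1.1.1 q.1.2) =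
        fun q : M.preExit => M.flow q.1.1.1 (max q.1.2 0) := by
      ext1 q; rw [max_eq_left q.2.1]
    rw [this]
    exact M.continuous_flow_max.measurable.comp
      (f := fun q : M.preExit => ((q.1.1.1 : EuclideanSpace ℝ (Fin m)), q.1.2)) (by fun_prop)
  · exact M.ell_measurable.comp (f := fun q : M.preExit =>
      (q.1.1.1, q.1.1.2.1, (⟨q.1.2, q.2.1⟩ : Ici (0 : ℝ))))
      (by refine Measurable.prodMk (by fun_prop) (Measurable.prodMk (by fun_prop) ?_)
          exact Measurable.subtype_mk (by fun_prop))

/-- The state and the action in force at a time before the exit. -/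
def preExitAction (q : M.preExit) : M.E × U := ((M.preExitPoint q).1, q.1.1.2.1)

lemma measurable_preExitAction : Measurable M.preExitAction :=
  (measurable_fst.comp M.measurable_preExitPoint).prodMk (by fun_prop)

lemma measurable_indicator_preExit {β : Type*} [MeasurableSpace β] [Zero β]
    {F : (M.E × U × U) × ℝ → β} (hF : Measurable (fun q : M.preExit => F q)) :
    Measurable (M.preExit.indicator F) := by
  refine measurable_of_restrict_of_restrict_compl M.measurableSet_preExit ?_ ?_
  · convert hF using 1
    ext q
    simp
  · convert (measurable_const : Measurable fun _ : ↥(M.preExit)ᶜ => (0 : β)) using 1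
    ext q
    simp [indicator_of_notMem q.2]

/-- An integral over the times before the exit depends measurably on the starting configuration. -/
lemma measurable_lintegral_timesBefore {F : (M.E × U × U) × ℝ → ℝ≥0∞}
    (hF : Measurable (fun q : M.preExit => F q)) :
    Measurable (fun p => ∫⁻ s in timesBefore (M.exitTime p.1), F (p, s)) := by
  have h := (M.measurable_indicator_preExit hF).lintegral_prod_right' (ν := volume)
  convert h using 2 with p
  rw [← lintegral_indicator (measurableSet_timesBefore _)]
  rfl

/-- The jump rate at a time before the exit. -/
def hazard (p : M.E × U × U) (s : ℝ) : ℝ≥0 := M.rate (M.flow p.1 s) (M.ell p.1 p.2.1 s)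

lemma measurable_hazard : Measurable (fun q : M.preExit => M.hazard q.1.1 q.1.2) := by
  have : Measurable (fun p : M.E × V => M.rate p.1 p.2) :=
    M.rate_measurable.comp (f := fun p : M.E × V =>
      ((⟨p.1, subset_closure p.1.2⟩ : closure M.E), p.2))
      ((Measurable.subtype_mk (by fun_prop)).prodMk measurable_snd)
  exact this.comp M.measurable_preExitPoint

lemma cumRate_eq (p : M.E × U × U) (τ : ℝ≥0∞) :
    M.cumRate p.1 p.2.1 τ = ∫⁻ s in timesBefore τ, (M.hazard p s : ℝ≥0∞) := rfl

lemma measurable_cumRate_preExit :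
    Measurable (fun q : M.preExit => M.cumRate q.1.1.1 q.1.1.2.1 (ENNReal.ofReal q.1.2)) := by
  have h1 : Measurable fun z : ((M.E × U × U) × ℝ) × ℝ =>
      {z : ((M.E × U × U) × ℝ) × ℝ | z.2 < z.1.2}.indicator
        (fun z => M.preExit.indicator (fun q => (M.hazard q.1 q.2 : ℝ≥0∞)) (z.1.1, z.2)) z := by
    refine Measurable.indicator ?_ (measurableSet_lt measurable_snd
      (measurable_snd.comp measurable_fst))
    exact (M.measurable_indicator_preExit (F := fun q => (M.hazard q.1 q.2 : ℝ≥0∞))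
      M.measurable_hazard.coe_nnreal_ennreal).comp (by fun_prop)
  have h2 := (h1.lintegral_prod_right' (ν := volume)).comp
    (measurable_subtype_coe : Measurable fun q : M.preExit => q.1)
  convert h2 using 1
  ext q
  rw [M.cumRate_eq q.1.1, Function.comp_apply, ← lintegral_indicator (measurableSet_timesBefore _)]
  congr 1
  ext s
  by_cases hs : s ∈ timesBefore (ENNReal.ofReal q.1.2)
  · have hs' : ((q.1.1, s) : (M.E × U × U) × ℝ) ∈ M.preExit :=
      timesBefore_mono q.2.2.le hs
    rw [indicator_of_mem hs, indicator_of_mem (by rw [timesBefore_ofReal] at hs; exact hs.2),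
      indicator_of_mem hs']
  · rw [indicator_of_notMem hs]
    by_cases h3 : s < q.1.2
    · rw [indicator_of_mem (by exact h3), indicator_of_notMem]
      intro h4
      exact hs (by rw [timesBefore_ofReal]; exact ⟨h4.1, h3⟩)
    · rw [indicator_of_notMem (by exact h3)]

lemma measurable_cumRate_exitTime :
    Measurable (fun p : M.E × U × U => M.cumRate p.1 p.2.1 (M.exitTime p.1)) :=
  M.measurable_lintegral_timesBefore (F := fun q => (M.hazard q.1 q.2 : ℝ≥0∞))
    M.measurable_hazard.coe_nnreal_ennreal

lemma disc_eq (α : ℝ) (x : M.E) (a : U) (τ : ℝ≥0∞) :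
    M.disc α x a τ = expNeg (ENNReal.ofReal α * τ) * expNeg (M.cumRate x a τ) := by
  rw [← expNeg_add]; rfl

lemma survival_eq_of_lt {x : M.E} {a : U} {t : ℝ} (h : ENNReal.ofReal t < M.exitTime x) :
    M.survival x a t = expNeg (M.cumRate x a (ENNReal.ofReal t)) := if_pos h

lemma survival_eq_zero {x : M.E} {a : U} {t : ℝ} (h : M.exitTime x ≤ ENNReal.ofReal t) :
    M.survival x a t = 0 := if_neg h.not_gt

lemma measurable_disc_preExit (α : ℝ) :
    Measurable (fun q : M.preExit => M.disc α q.1.1.1 q.1.1.2.1 (ENNReal.ofReal q.1.2)) := by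
  simp_rw [disc_eq]
  refine (measurable_expNeg.comp ?_).mul (measurable_expNeg.comp M.measurable_cumRate_preExit)
  fun_prop

lemma measurable_disc_exitTime (α : ℝ) :
    Measurable (fun p : M.E × U × U => M.disc α p.1 p.2.1 (M.exitTime p.1)) := by
  simp_rw [disc_eq]
  refine (measurable_expNeg.comp ?_).mul (measurable_expNeg.comp M.measurable_cumRate_exitTime)
  exact (M.measurable_exitTime.comp measurable_fst).const_mul _

end PDMPModel

/-! ### Integration by parts for discounted absolutely continuous functions -/

/-- The derivative of `s ↦ exp (-∫_0^s q) v(s)` is `exp (-∫_0^s q) (g(s) - q(s) v(s))` when `v` is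
a primitive of `g`. -/
lemma integral_exp_neg_integral_mul {q g v : ℝ → ℝ} {T : ℝ} (hT : 0 ≤ T)
    (hq : IntervalIntegrable q volume 0 T) (hg : IntervalIntegrable g volume 0 T)
    (hv : ∀ t ∈ Icc 0 T, v t - v 0 = ∫ s in (0 : ℝ)..t, g s) :
    IntervalIntegrable (fun s => Real.exp (-∫ r in (0 : ℝ)..s, q r) * (g s - q s * v s))
      volume 0 T ∧
    ∫ s in (0 : ℝ)..T, Real.exp (-∫ r in (0 : ℝ)..s, q r) * (g s - q s * v s) =
      Real.exp (-∫ r in (0 : ℝ)..T, q r) * v T - v 0 := by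
  set P : ℝ → ℝ := fun s => ∫ r in (0 : ℝ)..s, q r with hP
  have hPac : AbsolutelyContinuousOnInterval P 0 T :=
    hq.absolutelyContinuousOnInterval_intervalIntegral (by simp)
  set W : ℝ → ℝ := fun s => v 0 + ∫ r in (0 : ℝ)..s, g r with hW
  have hWac : AbsolutelyContinuousOnInterval W 0 T := by
    have h1 : AbsolutelyContinuousOnInterval (fun _ : ℝ => v 0) 0 T :=
      (LipschitzWith.const (v 0)).lipschitzOnWith.absolutelyContinuousOnInterval
    exact h1.add (hg.absolutelyContinuousOnInterval_intervalIntegral (by simp))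
  have hWv : ∀ s ∈ Icc 0 T, W s = v s := fun s hs => by simp only [hW, ← hv s hs]; ring
  have hFac : AbsolutelyContinuousOnInterval (fun s => Real.exp (-P s)) 0 T := by
    -- the exponential is Lipschitz on the bounded range of `P`
    obtain ⟨C, hC⟩ := hPac.exists_bound
    have hLip : ∃ K, LipschitzOnWith K (fun x : ℝ => Real.exp (-x)) (Icc (-C) C) :=
      ContDiffOn.exists_lipschitzOnWith (n := 1) (by fun_prop) (by decide) (convex_Icc _ _)
        isCompact_Icc
    obtain ⟨K, hK⟩ := hLip
    rw [absolutelyContinuousOnInterval_iff] at hPac ⊢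
    intro ε hε
    obtain ⟨δ, hδ, h⟩ := hPac (ε / (K + 1)) (by positivity)
    refine ⟨δ, hδ, fun E hE hlen => ?_⟩
    have h1 := h E hE hlen
    calc ∑ i ∈ Finset.range E.1, dist (Real.exp (-P (E.2 i).1)) (Real.exp (-P (E.2 i).2))
        ≤ ∑ i ∈ Finset.range E.1, K * dist (P (E.2 i).1) (P (E.2 i).2) := by
          refine Finset.sum_le_sum fun i hi => hK.dist_le_mul _ ?_ _ ?_
          · exact abs_le.1 (hC _ (hE.1 i hi).1)
          · exact abs_le.1 (hC _ (hE.1 i hi).2)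
      _ = K * ∑ i ∈ Finset.range E.1, dist (P (E.2 i).1) (P (E.2 i).2) := by rw [Finset.mul_sum]
      _ ≤ (K + 1) * ∑ i ∈ Finset.range E.1, dist (P (E.2 i).1) (P (E.2 i).2) := by
          refine mul_le_mul_of_nonneg_right (by linarith) (Finset.sum_nonneg fun _ _ => dist_nonneg)
      _ < (K + 1) * (ε / (K + 1)) := by gcongr
      _ = ε := by field_simp
  have hderiv : ∀ᵐ x, x ∈ uIcc 0 T →
      deriv (fun s => Real.exp (-P s)) x * W x + Real.exp (-P x) * deriv W x =
        Real.exp (-P x) * (g x - q x * v x) := by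
    filter_upwards [hq.ae_hasDerivAt_integral, hg.ae_hasDerivAt_integral] with x hx1 hx2 hx
    have h1 : HasDerivAt P (q x) x := hx1 hx 0 (by simp)
    have h2 : HasDerivAt W (g x) x := (hx2 hx 0 (by simp)).const_add _
    have h3 : HasDerivAt (fun s => Real.exp (-P s)) (Real.exp (-P x) * -q x) x := h1.neg.exp
    rw [h3.deriv, h2.deriv, hWv x (by rwa [uIcc_of_le hT] at hx)]
    ring
  have hint : IntervalIntegrable
      (fun x => deriv (fun s => Real.exp (-P s)) x * W x + Real.exp (-P x) * deriv W x)
      volume 0 T :=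
    (hFac.intervalIntegrable_deriv.mul_continuousOn hWac.continuousOn).add
      (hWac.intervalIntegrable_deriv.continuousOn_mul hFac.continuousOn)
  have hparts := hFac.integral_deriv_mul_eq_sub hWac
  constructor
  · refine hint.congr_ae ?_
    rw [EventuallyEq, ae_restrict_iff' measurableSet_uIoc]
    filter_upwards [hderiv] with x hx hxT using hx (uIoc_subset_uIcc hxT)
  · rw [← hWv T ⟨hT, le_rfl⟩]
    have h0 : v 0 = Real.exp (-P 0) * W 0 := by simp [hP, hW]
    rw [h0, ← hparts]
    refine intervalIntegral.integral_congr_ae ?_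
    filter_upwards [hderiv] with x hx hxT using (hx (uIoc_subset_uIcc hxT)).symm

namespace PDMPModel

variable {m n : ℕ} {U V : Type*} [MeasurableSpace U] [MeasurableSpace V] {M : PDMPModel m U V}

/-! ### The cumulated rate -/

lemma RateBounds.cumRate_lt_top (h : M.RateBounds) (p : M.E × U × U) {τ : ℝ≥0∞}
    (hτ : τ ≤ M.exitTime p.1) (hfin : τ < ∞) : M.cumRate p.1 p.2.1 τ < ∞ := by
  obtain ⟨hi, lo, Kl, -, -, hb, -, hint, -⟩ := h
  refine lt_of_le_of_lt ?_ (hint p.1 p.1.2 τ hτ hfin)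
  refine setLIntegral_mono' (measurableSet_timesBefore τ) fun s hs => ?_
  have := (hb _ (M.flow_mem_of_mem_timesBefore p.1.2 (timesBefore_mono hτ hs))
    (M.ell p.1 p.2.1 s)).1
  rw [← ENNReal.ofReal_coe_nnreal]
  exact ENNReal.ofReal_le_ofReal this

variable (M) in
lemma measurable_hazard_timesBefore (p : M.E × U × U) :
    Measurable ((timesBefore (M.exitTime p.1)).indicator (M.hazard p)) := by
  have := (M.measurable_indicator_preExit (F := fun q => M.hazard q.1 q.2)
    M.measurable_hazard).comp (measurable_prodMk_left (x := p))
  exact this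

variable (M) in
lemma aemeasurable_hazard (p : M.E × U × U) {τ : ℝ≥0∞} (hτ : τ ≤ M.exitTime p.1) :
    AEMeasurable (M.hazard p) (volume.restrict (timesBefore τ)) := by
  have h1 : AEMeasurable (M.hazard p) (volume.restrict (timesBefore (M.exitTime p.1))) :=
    (aemeasurable_indicator_iff (measurableSet_timesBefore _)).1
      (M.measurable_hazard_timesBefore p).aemeasurable
  exact h1.mono_measure (Measure.restrict_mono_set _ (timesBefore_mono hτ))

lemma RateBounds.intervalIntegrable_hazard (h : M.RateBounds) (p : M.E × U × U) {T : ℝ}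
    (hT0 : 0 ≤ T) (hT : ENNReal.ofReal T ≤ M.exitTime p.1) :
    IntervalIntegrable (fun s => (M.hazard p s : ℝ)) volume 0 T := by
  rw [intervalIntegrable_iff_integrableOn_Ico_of_le hT0, ← timesBefore_ofReal]
  refine ⟨(M.aemeasurable_hazard p hT).coe_nnreal_real.aestronglyMeasurable, ?_⟩
  have := h.cumRate_lt_top p hT ENNReal.ofReal_lt_top
  rw [HasFiniteIntegral]
  convert this using 1
  rw [M.cumRate_eq]
  simp [← ofReal_norm]

lemma RateBounds.cumRate_ofReal (h : M.RateBounds) (p : M.E × U × U) {T : ℝ}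
    (hT0 : 0 ≤ T) (hT : ENNReal.ofReal T ≤ M.exitTime p.1) :
    M.cumRate p.1 p.2.1 (ENNReal.ofReal T) =
      ENNReal.ofReal (∫ s in (0 : ℝ)..T, (M.hazard p s : ℝ)) := by
  rw [M.cumRate_eq, intervalIntegral.integral_of_le hT0, ← integral_Ico_eq_integral_Ioc,
    ofReal_integral_eq_lintegral_ofReal, timesBefore_ofReal]
  · simp
  · have := h.intervalIntegrable_hazard p hT0 hT
    rwa [intervalIntegrable_iff_integrableOn_Ico_of_le hT0] at this
  · exact ae_of_all _ fun _ => NNReal.coe_nonneg _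

/-- The discount factor is the exponential of a real integral before the exit. -/
lemma RateBounds.disc_ofReal (h : M.RateBounds) {α : ℝ} (hα : 0 ≤ α) (p : M.E × U × U) {T : ℝ}
    (hT0 : 0 ≤ T) (hT : ENNReal.ofReal T ≤ M.exitTime p.1) :
    M.disc α p.1 p.2.1 (ENNReal.ofReal T) =
      ENNReal.ofReal (Real.exp (-∫ s in (0 : ℝ)..T, (α + M.hazard p s : ℝ))) := by
  have h0 : 0 ≤ ∫ s in (0 : ℝ)..T, (M.hazard p s : ℝ) :=
    intervalIntegral.integral_nonneg hT0 fun _ _ => NNReal.coe_nonneg _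
  rw [disc_eq, ← expNeg_add, h.cumRate_ofReal p hT0 hT, ← ENNReal.ofReal_mul hα,
    ← ENNReal.ofReal_add (by positivity) h0, expNeg_ofReal (by positivity),
    intervalIntegral.integral_add (by simp) (h.intervalIntegrable_hazard p hT0 hT)]
  congr 3
  simp [mul_comm]

/-! ### The law of the sojourn time -/

variable (M) in
lemma tendsto_disc (α : ℝ) (p : M.E × U × U) {τ : ℝ≥0∞} {u : ℕ → ℝ≥0∞}
    (hu : Monotone u) (hut : Tendsto u atTop (𝓝 τ)) :
    Tendsto (fun k => M.disc α p.1 p.2.1 (u k)) atTop (𝓝 (M.disc α p.1 p.2.1 τ)) := by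
  have h1 := tendsto_lintegral_timesBefore (fun s => (M.hazard p s : ℝ≥0∞)) hu hut
  have h2 : Tendsto (fun k => ENNReal.ofReal α * u k + M.cumRate p.1 p.2.1 (u k)) atTop
      (𝓝 (ENNReal.ofReal α * τ + M.cumRate p.1 p.2.1 τ)) :=
    (ENNReal.Tendsto.const_mul hut (Or.inr ENNReal.ofReal_ne_top)).add h1
  exact (continuous_expNeg.tendsto _).comp h2

/-- A jump takes place in `[0, τ)` with the rate `λ e^{-Λ}`, and later with the remaining
probability `e^{-Λ(τ)}`. -/
lemma RateBounds.lintegral_hazard_add (h : M.RateBounds) (p : M.E × U × U) {τ : ℝ≥0∞}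
    (hτ : τ ≤ M.exitTime p.1) :
    (∫⁻ s in timesBefore τ,
      M.hazard p s * expNeg (M.cumRate p.1 p.2.1 (ENNReal.ofReal s))) +
      expNeg (M.cumRate p.1 p.2.1 τ) = 1 := by
  have hfin : ∀ T : ℝ, 0 ≤ T → ENNReal.ofReal T ≤ M.exitTime p.1 →
      (∫⁻ s in timesBefore (ENNReal.ofReal T),
        M.hazard p s * expNeg (M.cumRate p.1 p.2.1 (ENNReal.ofReal s))) +
        expNeg (M.cumRate p.1 p.2.1 (ENNReal.ofReal T)) = 1 := by
    intro T hT0 hT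
    have hle : ∀ s ∈ Ico 0 T, ENNReal.ofReal s ≤ M.exitTime p.1 := fun s hs =>
      (ENNReal.ofReal_le_ofReal hs.2.le).trans hT
    have hnn : ∀ s, 0 ≤ s → 0 ≤ ∫ r in (0 : ℝ)..s, (M.hazard p r : ℝ) := fun s hs =>
      intervalIntegral.integral_nonneg hs fun _ _ => NNReal.coe_nonneg _
    obtain ⟨hi, he⟩ := integral_exp_neg_integral_mul (g := fun _ => 0) (v := fun _ => 1) hT0
      (h.intervalIntegrable_hazard p hT0 hT) (by simp) (by simp)
    simp only [zero_sub, mul_one, mul_neg, intervalIntegral.integral_neg] at he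
    have hi' := hi.neg
    simp only [zero_sub, mul_one, mul_neg, neg_neg, Pi.neg_def] at hi'
    rw [intervalIntegrable_iff_integrableOn_Ico_of_le hT0] at hi'
    rw [timesBefore_ofReal, h.cumRate_ofReal p hT0 hT, expNeg_ofReal (hnn T hT0)]
    have h1 : ∫⁻ s in Ico 0 T,
        M.hazard p s * expNeg (M.cumRate p.1 p.2.1 (ENNReal.ofReal s)) =
        ENNReal.ofReal (∫ s in Ico 0 T,
          Real.exp (-∫ r in (0 : ℝ)..s, (M.hazard p r : ℝ)) * M.hazard p s) := by
      rw [ofReal_integral_eq_lintegral_ofReal hi'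
        (ae_of_all _ fun s => mul_nonneg (Real.exp_nonneg _) (NNReal.coe_nonneg _))]
      refine setLIntegral_congr_fun measurableSet_Ico fun s hs => ?_
      rw [h.cumRate_ofReal p hs.1 (hle s hs), expNeg_ofReal (hnn s hs.1),
        ENNReal.ofReal_mul (Real.exp_nonneg _), ENNReal.ofReal_coe_nnreal, mul_comm]
    rw [h1, integral_Ico_eq_integral_Ioc, ← intervalIntegral.integral_of_le hT0,
      ← ENNReal.ofReal_add _ (Real.exp_nonneg _)]
    · rw [← ENNReal.ofReal_one]
      congr 1
      linarith
    · exact intervalIntegral.integral_nonneg hT0 fun s _ =>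
        mul_nonneg (Real.exp_nonneg _) (NNReal.coe_nonneg _)
  rcases eq_or_ne τ ∞ with rfl | hne
  · have hmono : Monotone fun k : ℕ => ENNReal.ofReal k := fun i j hij =>
      ENNReal.ofReal_le_ofReal (by exact_mod_cast hij)
    have hlim : Tendsto (fun k : ℕ => ENNReal.ofReal k) atTop (𝓝 ∞) :=
      ENNReal.tendsto_ofReal_atTop.comp tendsto_natCast_atTop_atTop
    have h1 := (tendsto_lintegral_timesBefore (fun s =>
      M.hazard p s * expNeg (M.cumRate p.1 p.2.1 (ENNReal.ofReal s))) hmono hlim).add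
      ((continuous_expNeg.tendsto _).comp
        (tendsto_lintegral_timesBefore (fun s => (M.hazard p s : ℝ≥0∞)) hmono hlim))
    refine tendsto_nhds_unique h1 ?_
    refine tendsto_const_nhds.congr fun k => (hfin k k.cast_nonneg ?_).symm
    exact le_top.trans hτ
  · have := hfin τ.toReal ENNReal.toReal_nonneg (by rwa [ENNReal.ofReal_toReal hne])
    rwa [ENNReal.ofReal_toReal hne] at this

variable (M) in
/-- The law on `[0, ∞]` of the sojourn time that starts in the configuration `p`: it has the
density `λ e^{-Λ}` before the exit time, and the remaining mass sits at the exit time (at `∞` if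
the boundary is never reached). -/
noncomputable def sojournLaw (p : M.E × U × U) : Measure ℝ≥0∞ :=
  ((volume.restrict (timesBefore (M.exitTime p.1))).withDensity
    (fun s => M.hazard p s * expNeg (M.cumRate p.1 p.2.1 (ENNReal.ofReal s)))).map ENNReal.ofReal +
  expNeg (M.cumRate p.1 p.2.1 (M.exitTime p.1)) • Measure.dirac (M.exitTime p.1)

variable (M) in
lemma measurable_density_preExit : Measurable (fun q : M.preExit =>
    (M.hazard q.1.1 q.1.2 : ℝ≥0∞) *
      expNeg (M.cumRate q.1.1.1 q.1.1.2.1 (ENNReal.ofReal q.1.2))) :=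
  M.measurable_hazard.coe_nnreal_ennreal.mul
    (measurable_expNeg.comp M.measurable_cumRate_preExit)

variable (M) in
lemma aemeasurable_of_preExit (p : M.E × U × U) {F : (M.E × U × U) × ℝ → ℝ≥0∞}
    (hF : Measurable (fun q : M.preExit => F q)) :
    AEMeasurable (fun s => F (p, s)) (volume.restrict (timesBefore (M.exitTime p.1))) :=
  (aemeasurable_indicator_iff (measurableSet_timesBefore _)).1
    ((M.measurable_indicator_preExit hF).comp (measurable_prodMk_left (x := p))).aemeasurable

variable (M) in
lemma lintegral_sojournLaw (p : M.E × U × U) {h : ℝ≥0∞ → ℝ≥0∞} (hh : Measurable h) :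
    ∫⁻ s, h s ∂(M.sojournLaw p) =
      (∫⁻ s in timesBefore (M.exitTime p.1),
        M.hazard p s * expNeg (M.cumRate p.1 p.2.1 (ENNReal.ofReal s)) * h (ENNReal.ofReal s)) +
      expNeg (M.cumRate p.1 p.2.1 (M.exitTime p.1)) * h (M.exitTime p.1) := by
  have hdens := M.aemeasurable_of_preExit p (F := fun q => (M.hazard q.1 q.2 : ℝ≥0∞) *
      expNeg (M.cumRate q.1.1 q.1.2.1 (ENNReal.ofReal q.2))) M.measurable_density_preExit
  rw [sojournLaw, lintegral_add_measure, lintegral_smul_measure, lintegral_dirac' _ hh,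
    lintegral_map hh ENNReal.measurable_ofReal,
    lintegral_withDensity_eq_lintegral_mul₀ hdens (by fun_prop)]
  rfl

lemma RateBounds.isProbabilityMeasure_sojournLaw (h : M.RateBounds) (p : M.E × U × U) :
    IsProbabilityMeasure (M.sojournLaw p) := by
  constructor
  have := M.lintegral_sojournLaw p (h := fun _ => 1) measurable_const
  simp only [lintegral_const, one_mul, mul_one] at this
  rw [this]
  exact h.lintegral_hazard_add p le_rfl

variable (M) in
lemma measurable_sojournLaw : Measurable M.sojournLaw := by
  refine Measure.measurable_of_measurable_coe _ fun s hs => ?_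
  have hind : Measurable (s.indicator (1 : ℝ≥0∞ → ℝ≥0∞)) := measurable_one.indicator hs
  have : ∀ p, M.sojournLaw p s = _ := fun p => by
    rw [← lintegral_indicator_one hs, M.lintegral_sojournLaw p hind]
  simp_rw [this]
  refine Measurable.add (M.measurable_lintegral_timesBefore (F := fun q =>
      (M.hazard q.1 q.2 : ℝ≥0∞) * expNeg (M.cumRate q.1.1 q.1.2.1 (ENNReal.ofReal q.2)) *
      s.indicator 1 (ENNReal.ofReal q.2)) ?_) ?_
  · exact M.measurable_density_preExit.mul (hind.comp (by fun_prop))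
  · exact (measurable_expNeg.comp M.measurable_cumRate_exitTime).mul
      (hind.comp (M.measurable_exitTime.comp measurable_fst))

/-- The tail of the sojourn law is the survival function. -/
lemma RateBounds.sojournLaw_Ioi (h : M.RateBounds) (p : M.E × U × U) {t : ℝ} (ht : 0 ≤ t) :
    M.sojournLaw p (Ioi (ENNReal.ofReal t)) = M.survival p.1 p.2.1 t := by
  have hind : Measurable ((Ioi (ENNReal.ofReal t)).indicator (1 : ℝ≥0∞ → ℝ≥0∞)) :=
    measurable_one.indicator measurableSet_Ioi
  have := h.isProbabilityMeasure_sojournLaw p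
  rcases lt_or_ge (ENNReal.ofReal t) (M.exitTime p.1) with hlt | hge
  · rw [M.survival_eq_of_lt hlt]
    have hind' : Measurable ((Iic (ENNReal.ofReal t)).indicator (1 : ℝ≥0∞ → ℝ≥0∞)) :=
      measurable_one.indicator measurableSet_Iic
    -- the complementary probability is an integral over `[0, t]`
    have h1 : M.sojournLaw p (Iic (ENNReal.ofReal t)) =
        ∫⁻ s in timesBefore (ENNReal.ofReal t),
          M.hazard p s * expNeg (M.cumRate p.1 p.2.1 (ENNReal.ofReal s)) := by
      rw [← lintegral_indicator_one measurableSet_Iic, M.lintegral_sojournLaw p hind',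
        indicator_of_notMem (by simpa using hlt), mul_zero, add_zero, timesBefore_ofReal,
        setLIntegral_congr Ico_ae_eq_Icc, ← lintegral_indicator (measurableSet_timesBefore _),
        ← lintegral_indicator measurableSet_Icc]
      congr 1
      ext s
      by_cases hs : s ∈ Icc 0 t
      · have hs' : s ∈ timesBefore (M.exitTime p.1) :=
          ⟨hs.1, (ENNReal.ofReal_le_ofReal hs.2).trans_lt hlt⟩
        rw [indicator_of_mem hs, indicator_of_mem hs', indicator_of_mem
          (by exact ENNReal.ofReal_le_ofReal hs.2)]
        simp
      · rw [indicator_of_notMem hs]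
        by_cases hs' : s ∈ timesBefore (M.exitTime p.1)
        · rw [indicator_of_mem hs', indicator_of_notMem, mul_zero]
          intro h3
          exact hs ⟨hs'.1, (ENNReal.ofReal_le_ofReal_iff ht).1 h3⟩
        · rw [indicator_of_notMem hs']
    have h2 := h.lintegral_hazard_add p hlt.le
    rw [← h1] at h2
    have h3 := measure_add_measure_compl (μ := M.sojournLaw p)
      (measurableSet_Iic (a := ENNReal.ofReal t))
    rw [measure_univ, compl_Iic, ← h2] at h3
    exact (ENNReal.add_right_inj (measure_ne_top _ _)).1 h3
  · rw [M.survival_eq_zero hge, ← lintegral_indicator_one measurableSet_Ioi,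
      M.lintegral_sojournLaw p hind, indicator_of_notMem (by simpa using hge), mul_zero, add_zero]
    refine (setLIntegral_congr_fun (measurableSet_timesBefore _) fun s hs => ?_).trans
      lintegral_zero
    rw [indicator_of_notMem, mul_zero]
    exact not_lt.2 (hs.2.le.trans hge)

variable (M) in
/-- The sojourn does not outlast the exit time. -/
lemma ae_le_exitTime (p : M.E × U × U) :
    ∀ᵐ s ∂(M.sojournLaw p), s ≤ M.exitTime p.1 := by
  rw [ae_iff]
  have hmeas : MeasurableSet {s : ℝ≥0∞ | ¬ s ≤ M.exitTime p.1} := measurableSet_Iic.compl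
  rw [← lintegral_indicator_one hmeas, M.lintegral_sojournLaw p (measurable_one.indicator hmeas),
    indicator_of_notMem (by simp), mul_zero, add_zero]
  refine (setLIntegral_congr_fun (measurableSet_timesBefore _) fun s hs => ?_).trans
    lintegral_zero
  rw [indicator_of_notMem, mul_zero]
  simpa using hs.2.le

end PDMPModel

namespace PDMPModel

variable {m n : ℕ} {U V : Type*} [MeasurableSpace U] [MeasurableSpace V] (M : PDMPModel m U V)

/-! ### The kernel `G` -/

open Classical in
/-- The distribution of the location after a sojourn of length `s ≤ t_*` in the configuration
`p`. -/
noncomputable def landing (q : (M.E × U × U) × ℝ≥0∞) : Measure M.E :=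
  if q.2 < M.exitTime q.1.1 then
    M.Q (M.flow q.1.1 q.2.toReal) (M.ell q.1.1 q.1.2.1 q.2.toReal)
  else M.Qb (M.exitPoint q.1.1) q.1.2.2

lemma toReal_mem_timesBefore {s τ : ℝ≥0∞} (h : s < τ) : s.toReal ∈ timesBefore τ :=
  ⟨ENNReal.toReal_nonneg, by rwa [ENNReal.ofReal_toReal h.ne_top]⟩

lemma measurable_landing : Measurable M.landing := by
  have hmeas : MeasurableSet {q : (M.E × U × U) × ℝ≥0∞ | q.2 < M.exitTime q.1.1} :=
    measurableSet_lt measurable_snd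
      (M.measurable_exitTime.comp (measurable_fst.comp measurable_fst))
  have hb : Measurable fun q : (M.E × U × U) × ℝ≥0∞ => M.Qb (M.exitPoint q.1.1) q.1.2.2 :=
    M.Qb_measurable.comp (f := fun q : (M.E × U × U) × ℝ≥0∞ =>
      ((⟨M.exitPoint q.1.1, M.exitPoint_mem_frontier q.1.1.2⟩ : frontier M.E), q.1.2.2))
      ((Measurable.subtype_mk (M.measurable_exitPoint.comp (by fun_prop))).prodMk (by fun_prop))
  refine measurable_of_restrict_of_restrict_compl hmeas ?_ ?_
  · have h1 : Measurable fun q : {q : (M.E × U × U) × ℝ≥0∞ | q.2 < M.exitTime q.1.1} =>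
        (⟨(q.1.1, q.1.2.toReal), toReal_mem_timesBefore q.2⟩ : M.preExit) :=
      Measurable.subtype_mk (by fun_prop)
    convert M.Q_measurable.comp (M.measurable_preExitPoint.comp h1) using 1
    ext1 q
    exact if_pos q.2
  · convert hb.comp (measurable_subtype_coe :
      Measurable fun q : ↥{q : (M.E × U × U) × ℝ≥0∞ | q.2 < M.exitTime q.1.1}ᶜ => q.1) using 1
    ext1 q
    exact if_neg q.2

lemma isProbabilityMeasure_landing (q : (M.E × U × U) × ℝ≥0∞) :
    IsProbabilityMeasure (M.landing q) := by
  unfold landing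
  split_ifs with h
  · exact M.Q_prob _ (M.flow_mem_of_mem_timesBefore q.1.1.2 (toReal_mem_timesBefore h)) _
  · exact M.Qb_prob _ (M.exitPoint_mem_frontier q.1.1.2) _

lemma postJump_eq_landing (p : M.E × U × U) {s : ℝ≥0∞} (hs : s ≤ M.exitTime p.1) (hfin : s < ∞) :
    M.postJump p s.toReal = M.landing (p, s) := by
  unfold postJump landing
  rcases hs.lt_or_eq with h | rfl
  · rw [if_pos (M.flow_mem_of_mem_timesBefore p.1.2 (toReal_mem_timesBefore h)), if_pos h]
  · have he : M.exitPoint p.1 = M.flow p.1 (M.exitTime p.1).toReal := if_neg hfin.ne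
    have hfr := M.exitPoint_mem_frontier p.1.2
    rw [he] at hfr
    rw [if_neg, if_neg (lt_irrefl _), he]
    exact fun hx => (disjoint_frontier_iff_isOpen.2 M.isOpen_E).ne_of_mem hfr hx rfl

/-- The operator `G` averages the location after the jump and the discounting over the sojourn
time. -/
lemma opG_eq_lintegral_sojournLaw (α : ℝ) {h : M.E → ℝ≥0∞} (hh : Measurable h)
    (p : M.E × U × U) :
    M.opG α h p =
      ∫⁻ s, expNeg (ENNReal.ofReal α * s) * ∫⁻ y, h y ∂(M.landing (p, s)) ∂(M.sojournLaw p) := by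
  have h1 : Measurable fun s => ∫⁻ y, h y ∂(M.landing (p, s)) :=
    (Measure.measurable_lintegral hh).comp (M.measurable_landing.comp measurable_prodMk_left)
  have h2 : Measurable fun s : ℝ≥0∞ => expNeg (ENNReal.ofReal α * s) :=
    measurable_expNeg.comp (by fun_prop)
  have h3 := M.lintegral_sojournLaw p (h2.mul h1)
  simp only [Pi.mul_apply] at h3
  rw [h3, opG]
  congr 1
  · refine setLIntegral_congr_fun (measurableSet_timesBefore _) fun s hs => ?_
    have : M.landing (p, ENNReal.ofReal s) = M.Q (M.flow p.1 s) (M.ell p.1 p.2.1 s) := by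
      rw [landing, if_pos hs.2, ENNReal.toReal_ofReal hs.1]
    simp only [this, disc_eq, hazard]
    ring
  · have : M.landing (p, M.exitTime p.1) = M.Qb (M.exitPoint p.1) p.2.2 := if_neg (lt_irrefl _)
    simp only [this, disc_eq]
    ring

lemma measurable_opG (α : ℝ) {h : M.E → ℝ≥0∞} (hh : Measurable h) : Measurable (M.opG α h) := by
  have hb : Measurable fun p : M.E × U × U => M.Qb (M.exitPoint p.1) p.2.2 :=
    M.Qb_measurable.comp (f := fun p : M.E × U × U =>
      ((⟨M.exitPoint p.1, M.exitPoint_mem_frontier p.1.2⟩ : frontier M.E), p.2.2))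
      ((Measurable.subtype_mk (M.measurable_exitPoint.comp (by fun_prop))).prodMk (by fun_prop))
  refine Measurable.add (M.measurable_lintegral_timesBefore (F := fun q =>
    M.disc α q.1.1 q.1.2.1 (ENNReal.ofReal q.2) * M.rate (M.flow q.1.1 q.2)
      (M.ell q.1.1 q.1.2.1 q.2) *
      ∫⁻ y, h y ∂(M.Q (M.flow q.1.1 q.2) (M.ell q.1.1 q.1.2.1 q.2))) ?_) ?_
  · exact ((M.measurable_disc_preExit α).mul M.measurable_hazard.coe_nnreal_ennreal).mul
      ((Measure.measurable_lintegral hh).comp (M.Q_measurable.comp M.measurable_preExitPoint))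
  · exact (M.measurable_disc_exitTime α).mul ((Measure.measurable_lintegral hh).comp hb)

/-- The measure `G(p; ·)`. -/
noncomputable def jumpMeasure (α : ℝ) (p : M.E × U × U) : Measure M.E :=
  ((M.sojournLaw p).withDensity fun s => expNeg (ENNReal.ofReal α * s)).bind
    fun s => M.landing (p, s)

lemma lintegral_jumpMeasure (α : ℝ) (p : M.E × U × U) {h : M.E → ℝ≥0∞} (hh : Measurable h) :
    ∫⁻ y, h y ∂(M.jumpMeasure α p) = M.opG α h p := by
  have h1 : Measurable fun s => M.landing (p, s) := M.measurable_landing.comp measurable_prodMk_left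
  have h2 : Measurable fun s : ℝ≥0∞ => expNeg (ENNReal.ofReal α * s) :=
    measurable_expNeg.comp (by fun_prop)
  rw [jumpMeasure, Measure.lintegral_bind h1.aemeasurable hh.aemeasurable,
    lintegral_withDensity_eq_lintegral_mul _ h2
      (by exact (Measure.measurable_lintegral hh).comp h1), M.opG_eq_lintegral_sojournLaw α hh]
  rfl

/-- The kernel `G`. -/
noncomputable def jumpKernel (α : ℝ) : Kernel (M.E × U × U) M.E where
  toFun := M.jumpMeasure α
  measurable' := by
    refine Measure.measurable_of_measurable_coe _ fun B hB => ?_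
    have hB' : Measurable (B.indicator (1 : M.E → ℝ≥0∞)) := measurable_one.indicator hB
    convert M.measurable_opG α hB' using 1
    ext1 p
    rw [← M.lintegral_jumpMeasure α p hB', lintegral_indicator_one hB]

lemma lintegral_jumpKernel (α : ℝ) (p : M.E × U × U) {h : M.E → ℝ≥0∞} (hh : Measurable h) :
    ∫⁻ y, h y ∂(M.jumpKernel α p) = M.opG α h p := M.lintegral_jumpMeasure α p hh

lemma kerG_eq (α : ℝ) (p : M.E × U × U) {B : Set M.E} (hB : MeasurableSet B) :
    M.kerG α p B = M.jumpKernel α p B := by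
  rw [kerG, ← M.lintegral_jumpKernel α p (measurable_one.indicator hB), lintegral_indicator_one hB]

variable {M}

/-- The kernel `G` is substochastic. -/
lemma RateBounds.jumpKernel_univ_le (hr : M.RateBounds) (α : ℝ) (p : M.E × U × U) :
    M.jumpKernel α p univ ≤ 1 := by
  have := hr.isProbabilityMeasure_sojournLaw p
  have h1 := M.lintegral_jumpKernel α p (h := fun _ => 1) measurable_const
  simp only [lintegral_const, one_mul] at h1
  rw [h1, M.opG_eq_lintegral_sojournLaw α measurable_const]
  calc _ ≤ ∫⁻ _, 1 ∂(M.sojournLaw p) := by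
        refine lintegral_mono fun s => ?_
        have := M.isProbabilityMeasure_landing (p, s)
        simpa using expNeg_le_one _
    _ = 1 := by simp

lemma RateBounds.isFiniteKernel (hr : M.RateBounds) (α : ℝ) : IsFiniteKernel (M.jumpKernel α) :=
  ⟨⟨1, ENNReal.one_lt_top, hr.jumpKernel_univ_le α⟩⟩

/-! ### The Lyapunov inequality -/

/-- The growth condition yields a finite Lyapunov function `v`, dominated by the weight, such that
`G(v + κ) ≤ v` on `𝒦` for a constant `κ > 0`. -/
lemma GrowthCondition.exists_lyapunov {α c₀ : ℝ} (hα : 0 < α)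
    {f₀ r₀ : EuclideanSpace ℝ (Fin m) → U → ℝ≥0} (hr : M.RateBounds)
    (hg : M.GrowthCondition α c₀ f₀ r₀) :
    ∃ (v : M.E → ℝ≥0∞) (C : ℝ≥0) (κ : ℝ≥0∞), Measurable v ∧ κ ≠ 0 ∧ κ ≠ ∞ ∧
      (∀ x, v x ≤ C * M.weightInf α c₀ f₀ r₀ x) ∧
      ∀ p ∈ M.K, M.opG α (fun y => v y + κ) p ≤ v p.1 := by
  obtain ⟨-, -, -, -, b, v, Xv, c, hb, hc, ⟨hv, -, hvlim⟩, ⟨-, hXv⟩, hv0, ⟨C, hC⟩, -, hin, hbd⟩ :=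
    hg
  have hcα : 0 < c + α := by linarith
  refine ⟨fun x => ENNReal.ofReal (v x), C, ENNReal.ofReal (c + α), hv.ennreal_ofReal,
    by simpa using hcα, ENNReal.ofReal_ne_top, hC, fun p hp => ?_⟩
  have hQ : ∀ (ρ : Measure M.E) [IsProbabilityMeasure ρ], Integrable (fun y : M.E => v y) ρ →
      ∫⁻ y, (ENNReal.ofReal (v y) + ENNReal.ofReal (c + α)) ∂ρ =
        ENNReal.ofReal ((∫ y : M.E, v y ∂ρ) + (c + α)) := by
    intro ρ _ hρ
    rw [lintegral_add_right _ measurable_const, lintegral_const, measure_univ, mul_one,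
      ENNReal.ofReal_add (integral_nonneg fun y : M.E => hv0 y y.2) hcα.le,
      ofReal_integral_eq_lintegral_ofReal hρ (ae_of_all _ fun y : M.E => hv0 y y.2)]
  set τ := M.exitTime p.1 with hτ
  set ψ : ℝ → ℝ≥0∞ := fun s => M.disc α p.1 p.2.1 (ENNReal.ofReal s) *
    M.rate (M.flow p.1 s) (M.ell p.1 p.2.1 s) *
      ∫⁻ y, (ENNReal.ofReal (v y) + ENNReal.ofReal (c + α))
        ∂(M.Q (M.flow p.1 s) (M.ell p.1 p.2.1 s)) with hψ
  -- the inequality up to a time before the exit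
  have hbefore : ∀ u : ℝ≥0∞, u < τ → (∫⁻ s in timesBefore u, ψ s) +
      M.disc α p.1 p.2.1 u * ENNReal.ofReal (v (M.flow p.1 u.toReal)) ≤ ENNReal.ofReal (v p.1) := by
    intro u hu
    set T := u.toReal with hT
    have hT0 : 0 ≤ T := ENNReal.toReal_nonneg
    have hTu : ENNReal.ofReal T = u := ENNReal.ofReal_toReal hu.ne_top
    have hTmem : T ∈ timesBefore τ := toReal_mem_timesBefore hu
    have hTle : ENNReal.ofReal T ≤ τ := hTu.trans_le hu.le
    have hmem : ∀ s ∈ Icc 0 T, s ∈ timesBefore τ := fun s hs =>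
      ⟨hs.1, (ENNReal.ofReal_le_ofReal hs.2).trans_lt (hTu.trans_lt hu)⟩
    have hq : IntervalIntegrable (fun s => α + (M.hazard p s : ℝ)) volume 0 T :=
      (by simp : IntervalIntegrable (fun _ => α) volume 0 T).add
        (hr.intervalIntegrable_hazard p hT0 hTle)
    obtain ⟨hi, he⟩ := integral_exp_neg_integral_mul (v := fun s => v (M.flow p.1 s)) hT0 hq
      (hXv p.1 p.1.2 T hTmem).1 (fun t ht => by
        simp only [M.flow_zero]; exact (hXv p.1 p.1.2 t (hmem t ht)).2)
    simp only [M.flow_zero] at he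
    have hi' := hi.neg
    rw [intervalIntegrable_iff_integrableOn_Ico_of_le hT0] at hi'
    have hpt : ∀ s ∈ Ico 0 T, ψ s ≤ ENNReal.ofReal
        ((-(fun s => Real.exp (-∫ r in (0 : ℝ)..s, (α + M.hazard p r)) *
          (Xv (M.flow p.1 s) - (α + M.hazard p s) * v (M.flow p.1 s)))) s) ∧ 0 ≤
        (-(fun s => Real.exp (-∫ r in (0 : ℝ)..s, (α + M.hazard p r)) *
          (Xv (M.flow p.1 s) - (α + M.hazard p s) * v (M.flow p.1 s)))) s := by
      intro s hs
      have hs' := hmem s ⟨hs.1, hs.2.le⟩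
      obtain ⟨hQi, h1, h2⟩ := hin p hp s hs'
      have := M.Q_prob _ (M.flow_mem_of_mem_timesBefore p.1.2 hs') (M.ell p.1 p.2.1 s)
      have hQ0 : 0 ≤ ∫ y : M.E, v y ∂(M.Q (M.flow p.1 s) (M.ell p.1 p.2.1 s)) :=
        integral_nonneg fun y : M.E => hv0 y y.2
      have h3 : b (M.flow p.1 s) ≤ (c + α) * (v (M.flow p.1 s) - M.hazard p s) := by
        have h4 : 1 / (c + α) * b (M.flow p.1 s) ≤ v (M.flow p.1 s) - M.hazard p s := by
          have : (M.hazard p s : ℝ) + 1 / (c + α) * b (M.flow p.1 s) ≤ v (M.flow p.1 s) := h2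
          linarith
        have h5 := mul_le_mul_of_nonneg_left h4 hcα.le
        rwa [← mul_assoc, mul_one_div_cancel hcα.ne', one_mul] at h5
      have h6 : (M.hazard p s : ℝ) * ((∫ y : M.E, v y ∂(M.Q (M.flow p.1 s) (M.ell p.1 p.2.1 s))) +
          (c + α)) ≤ -(Xv (M.flow p.1 s) - (α + M.hazard p s) * v (M.flow p.1 s)) := by
        have h1' : Xv (M.flow p.1 s) + c * v (M.flow p.1 s) - M.hazard p s *
          (v (M.flow p.1 s) - ∫ y : M.E, v y ∂(M.Q (M.flow p.1 s) (M.ell p.1 p.2.1 s)))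
            ≤ b (M.flow p.1 s) := h1
        linarith
      have h7 : 0 ≤ (M.hazard p s : ℝ) *
          ((∫ y : M.E, v y ∂(M.Q (M.flow p.1 s) (M.ell p.1 p.2.1 s))) + (c + α)) := by positivity
      simp only [Pi.neg_apply, ← mul_neg]
      refine ⟨?_, mul_nonneg (Real.exp_nonneg _) (h7.trans h6)⟩
      rw [hψ]
      simp only
      rw [hQ _ hQi, hr.disc_ofReal hα.le p hs.1 ((ENNReal.ofReal_le_ofReal hs.2.le).trans hTle),
        ← ENNReal.ofReal_coe_nnreal, mul_assoc, ← ENNReal.ofReal_mul (NNReal.coe_nonneg _),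
        ← ENNReal.ofReal_mul (Real.exp_nonneg _)]
      exact ENNReal.ofReal_le_ofReal (mul_le_mul_of_nonneg_left h6 (Real.exp_nonneg _))
    have hle : ∫⁻ s in timesBefore u, ψ s ≤ ENNReal.ofReal
        (v p.1 - Real.exp (-∫ r in (0 : ℝ)..T, (α + M.hazard p r)) * v (M.flow p.1 T)) := by
      rw [← hTu, timesBefore_ofReal]
      refine (setLIntegral_mono' measurableSet_Ico fun s hs => (hpt s hs).1).trans ?_
      rw [← ofReal_integral_eq_lintegral_ofReal hi'
        (by filter_upwards [ae_restrict_mem measurableSet_Ico] with s hs using (hpt s hs).2)]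
      refine ENNReal.ofReal_le_ofReal ?_
      simp only [Pi.neg_apply]
      rw [integral_neg, integral_Ico_eq_integral_Ioc, ← intervalIntegral.integral_of_le hT0, he]
      linarith
    have hTv : 0 ≤ Real.exp (-∫ r in (0 : ℝ)..T, (α + M.hazard p r)) * v (M.flow p.1 T) :=
      mul_nonneg (Real.exp_nonneg _) (hv0 _ (M.flow_mem_of_mem_timesBefore p.1.2 hTmem))
    rw [← hTu, hr.disc_ofReal hα.le p hT0 hTle, ← ENNReal.ofReal_mul (Real.exp_nonneg _), hTu]
    refine (add_le_add_left hle _).trans ?_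
    rcases le_or_gt (Real.exp (-∫ r in (0 : ℝ)..T, (α + M.hazard p r)) * v (M.flow p.1 T)) (v p.1)
      with h8 | h8
    · rw [← ENNReal.ofReal_add (by linarith) hTv]
      exact ENNReal.ofReal_le_ofReal (by linarith)
    · -- the integral of a nonnegative function cannot be negative
      exfalso
      have h9 : 0 ≤ ∫ s in (0 : ℝ)..T, -(Real.exp (-∫ r in (0 : ℝ)..s, (α + M.hazard p r)) *
          (Xv (M.flow p.1 s) - (α + M.hazard p s) * v (M.flow p.1 s))) := by
        rw [intervalIntegral.integral_of_le hT0, ← integral_Ico_eq_integral_Ioc]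
        exact setIntegral_nonneg measurableSet_Ico fun s hs => (hpt s hs).2
      rw [intervalIntegral.integral_neg, he] at h9
      linarith
  -- passage to the exit time
  obtain ⟨u, humono, hu, hut⟩ := exists_seq_strictMono_tendsto' (M.exitTime_pos p.1.2)
  have hint := tendsto_lintegral_timesBefore ψ humono.monotone hut
  have hdisc := M.tendsto_disc α p humono.monotone hut
  change (∫⁻ s in timesBefore τ, ψ s) + M.disc α p.1 p.2.1 τ *
    ∫⁻ y, (ENNReal.ofReal (v y) + ENNReal.ofReal (c + α)) ∂(M.Qb (M.exitPoint p.1) p.2.2) ≤ _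
  rcases eq_or_ne τ ∞ with h | h
  · have : M.disc α p.1 p.2.1 τ = 0 := by
      rw [disc_eq, h, ENNReal.mul_top (by simpa using hα), expNeg_top, zero_mul]
    rw [this, zero_mul, add_zero]
    exact le_of_tendsto' hint fun k => le_self_add.trans (hbefore (u k) (hu k).2)
  · obtain ⟨l, hl⟩ := hvlim p.1 p.1.2 h.lt_top
    obtain ⟨hQi, hQl⟩ := hbd p hp h.lt_top
    have := M.Qb_prob _ (M.exitPoint_mem_frontier p.1.2) p.2.2
    have hureal : Tendsto (fun k => (u k).toReal) atTop (𝓝[<] τ.toReal) := by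
      refine tendsto_nhdsWithin_iff.2 ⟨(ENNReal.tendsto_toReal h).comp hut, ?_⟩
      exact Eventually.of_forall fun k => ENNReal.toReal_strict_mono h (hu k).2
    have hvl : Tendsto (fun k => ENNReal.ofReal (v (M.flow p.1 (u k).toReal))) atTop
        (𝓝 (ENNReal.ofReal l)) := ENNReal.tendsto_ofReal (hl.comp hureal)
    have hlim := hint.add (ENNReal.Tendsto.mul hdisc (Or.inr ENNReal.ofReal_ne_top) hvl
      (Or.inr (by rw [disc_eq, ← expNeg_add]; exact expNeg_ne_top _)))
    refine le_trans ?_ (le_of_tendsto' hlim fun k => hbefore (u k) (hu k).2)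
    rw [hQ _ hQi]
    gcongr
    exact hQl l hl

end PDMPModel

namespace PDMPModel

variable {m n : ℕ} {U V : Type*} [MeasurableSpace U] [MeasurableSpace V] {M : PDMPModel m U V}

/-! ### Sequences of occupation measures -/

variable (M) in
/-- The measures `μ k` on `𝒦` are the discounted laws of the successive states and actions of
some (possibly history-dependent) control: the states of index `0` have the law `ν₀`, and those
of index `k + 1` are obtained from the states and actions of index `k` through `G`. -/
structure IsOccupationSequence (α : ℝ) (ν₀ : Measure M.E) (μ : ℕ → Measure (M.E × U × U)) :
    Prop where
  support : ∀ k, μ k M.Kᶜ = 0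
  map_zero : (μ 0).map Prod.fst = ν₀
  map_succ : ∀ k, (μ (k + 1)).map Prod.fst = (μ k).bind (M.jumpKernel α)

namespace IsOccupationSequence

variable {α : ℝ} {ν₀ : Measure M.E} {μ : ℕ → Measure (M.E × U × U)}

lemma lintegral_succ (h : M.IsOccupationSequence α ν₀ μ) (k : ℕ) {g : M.E → ℝ≥0∞}
    (hg : Measurable g) : ∫⁻ p, g p.1 ∂(μ (k + 1)) = ∫⁻ p, M.opG α g p ∂(μ k) := by
  rw [← lintegral_map hg measurable_fst, h.map_succ,
    Measure.lintegral_bind (M.jumpKernel α).measurable.aemeasurable hg.aemeasurable]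
  simp_rw [M.lintegral_jumpKernel α _ hg]

lemma univ_le_one [IsProbabilityMeasure ν₀] (h : M.IsOccupationSequence α ν₀ μ)
    (hr : M.RateBounds) (k : ℕ) : μ k univ ≤ 1 := by
  induction k with
  | zero =>
    rw [← preimage_univ (f := Prod.fst), ← Measure.map_apply measurable_fst MeasurableSet.univ,
      h.map_zero, measure_univ]
  | succ k ih =>
    rw [← preimage_univ (f := Prod.fst), ← Measure.map_apply measurable_fst MeasurableSet.univ,
      h.map_succ, Measure.bind_apply MeasurableSet.univ (M.jumpKernel α).measurable.aemeasurable]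
    calc _ ≤ ∫⁻ _, 1 ∂(μ k) := lintegral_mono fun p => hr.jumpKernel_univ_le α p
      _ ≤ 1 := by simpa using ih

/-- The Lyapunov function bounds the total mass: it decreases by at least `κ` times the mass at
each step. -/
lemma sum_univ_lt_top [IsProbabilityMeasure ν₀] (h : M.IsOccupationSequence α ν₀ μ) (hα : 0 < α)
    (hr : M.RateBounds) {c₀ : ℝ} {f₀ r₀ : EuclideanSpace ℝ (Fin m) → U → ℝ≥0}
    (hg : M.GrowthCondition α c₀ f₀ r₀)
    (hcost : ∫⁻ p, M.stageCost α f₀ r₀ p ∂(Measure.sum μ) < ∞) :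
    Measure.sum μ univ < ∞ := by
  obtain ⟨v, C, κ, hv, hκ0, hκ, hvC, hG⟩ := hg.exists_lyapunov hα hr
  have hae : ∀ k, ∀ᵐ p ∂(μ k), p ∈ M.K := fun k => h.support k
  set a : ℕ → ℝ≥0∞ := fun k => ∫⁻ p, v p.1 ∂(μ k) with ha
  have hstep : ∀ k, a (k + 1) + κ * μ (k + 1) univ ≤ a k := by
    intro k
    have h1 := h.lintegral_succ k (g := fun y => v y + κ) (by fun_prop)
    rw [lintegral_add_right _ measurable_const, lintegral_const] at h1
    change a (k + 1) + _ = _ at h1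
    rw [h1]
    exact lintegral_mono_ae ((hae k).mono fun p hp => hG p hp)
  have ha0 : a 0 < ∞ := by
    have h1 : a 0 ≤ ∫⁻ p, C * M.weight α c₀ f₀ r₀ p ∂(μ 0) := by
      refine lintegral_mono_ae ((hae 0).mono fun p hp => (hvC p.1).trans ?_)
      gcongr
      exact iInf₂_le (f := fun c _ => M.weight α c₀ f₀ r₀ (p.1, c)) p.2 hp
    refine h1.trans_lt ?_
    rw [lintegral_const_mul' _ _ ENNReal.coe_ne_top]
    refine ENNReal.mul_lt_top ENNReal.coe_lt_top ?_
    unfold weight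
    rw [lintegral_add_left measurable_const, lintegral_const]
    refine ENNReal.add_lt_top.2 ⟨ENNReal.mul_lt_top ENNReal.ofReal_lt_top
      ((h.univ_le_one hr 0).trans_lt ENNReal.one_lt_top), lt_of_le_of_lt ?_ hcost⟩
    exact lintegral_mono' (Measure.le_sum μ 0) le_rfl
  have hsum : ∀ N, (∑ k ∈ Finset.range N, κ * μ (k + 1) univ) + a N ≤ a 0 := by
    intro N
    induction N with
    | zero => simp
    | succ N ih =>
      rw [Finset.sum_range_succ, add_assoc, add_comm (κ * _)]
      exact (add_le_add_right (hstep N) _).trans ih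
  have hts : κ * ∑' k, μ (k + 1) univ ≤ a 0 := by
    rw [← ENNReal.tsum_mul_left]
    exact ENNReal.tsum_le_of_sum_range_le fun N => le_self_add.trans (hsum N)
  rw [Measure.sum_apply _ MeasurableSet.univ, tsum_eq_zero_add' ENNReal.summable]
  refine ENNReal.add_lt_top.2 ⟨(h.univ_le_one hr 0).trans_lt ENNReal.one_lt_top, ?_⟩
  exact ENNReal.lt_top_of_mul_ne_top_right (hts.trans_lt ha0).ne hκ0

/-- The sum of an occupation sequence is a feasible measure as soon as its costs are
admissible. -/
lemma isFeasible_sum [IsProbabilityMeasure ν₀] (h : M.IsOccupationSequence α ν₀ μ) (hα : 0 < α)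
    (hr : M.RateBounds) {c₀ : ℝ} {f r : Fin (n + 1) → EuclideanSpace ℝ (Fin m) → U → ℝ≥0}
    {d : Fin n → ℝ} (hg : M.GrowthCondition α c₀ (f 0) (r 0))
    (hcost : ∫⁻ p, M.stageCost α (f 0) (r 0) p ∂(Measure.sum μ) < ∞)
    (hcons : ∀ i : Fin n,
      ((∫⁻ p, M.stageCost α (f i.succ) (r i.succ) p ∂(Measure.sum μ) : ℝ≥0∞) : EReal) ≤ d i) :
    M.IsFeasible α c₀ f r d ν₀ (Measure.sum μ) where
  finite := ⟨h.sum_univ_lt_top hα hr hg hcost⟩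
  support := Measure.sum_apply_eq_zero.2 h.support
  weight_lt_top := by
    unfold weight
    rw [lintegral_add_left measurable_const, lintegral_const]
    exact ENNReal.add_lt_top.2 ⟨ENNReal.mul_lt_top ENNReal.ofReal_lt_top
      (h.sum_univ_lt_top hα hr hg hcost), hcost⟩
  balance B hB := by
    rw [Measure.map_apply measurable_fst hB, Measure.sum_apply _ (measurable_fst hB),
      tsum_eq_zero_add' ENNReal.summable, lintegral_sum_measure]
    congr 1
    · rw [← Measure.map_apply measurable_fst hB, h.map_zero]
    · congr 1
      ext k
      rw [← Measure.map_apply measurable_fst hB, h.map_succ,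
        Measure.bind_apply hB (M.jumpKernel α).measurable.aemeasurable]
      simp_rw [M.kerG_eq α _ hB]
  constraint := hcons

end IsOccupationSequence

section Stationary

variable [StandardBorelSpace U]

/-- The occupation sequence of the stationary randomized policy obtained by disintegrating a
feasible measure sums up to at most that measure. -/
lemma IsFeasible.exists_isOccupationSequence {α c₀ : ℝ} (hr : M.RateBounds)
    {f r : Fin (n + 1) → EuclideanSpace ℝ (Fin m) → U → ℝ≥0} {d : Fin n → ℝ} {ν₀ : Measure M.E}
    [IsProbabilityMeasure ν₀] {μ : Measure (M.E × U × U)} (h : M.IsFeasible α c₀ f r d ν₀ μ) :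
    ∃ ρ : ℕ → Measure (M.E × U × U), M.IsOccupationSequence α ν₀ ρ ∧ Measure.sum ρ ≤ μ := by
  have := h.finite
  have := hr.isFiniteKernel α
  have hμ0 : μ ≠ 0 := by
    rintro rfl
    have := h.balance univ MeasurableSet.univ
    simp at this
  have hne : Nonempty (U × U) := by
    have : NeZero μ := ⟨hμ0⟩
    obtain ⟨p⟩ := Measure.nonempty_of_neZero μ
    exact ⟨p.2⟩
  set φ := μ.condKernel with hφ
  have hdis : μ.fst ⊗ₘ φ = μ := μ.disintegrate φ
  have hbal : μ.fst = ν₀ + μ.bind (M.jumpKernel α) := by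
    ext B hB
    rw [Measure.add_apply, Measure.bind_apply hB (M.jumpKernel α).measurable.aemeasurable]
    simp_rw [← M.kerG_eq α _ hB]
    exact h.balance B hB
  obtain ⟨ρ, hρ0, hρs⟩ : ∃ ρ : ℕ → Measure (M.E × U × U), ρ 0 = ν₀ ⊗ₘ φ ∧
      ∀ k, ρ (k + 1) = ((ρ k).bind (M.jumpKernel α)) ⊗ₘ φ :=
    ⟨fun k => Nat.rec (ν₀ ⊗ₘ φ) (fun _ σ => (σ.bind (M.jumpKernel α)) ⊗ₘ φ) k, rfl, fun _ => rfl⟩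
  have hfin : ∀ k, IsFiniteMeasure (ρ k) := by
    intro k
    induction k with
    | zero => rw [hρ0]; infer_instance
    | succ k ih => rw [hρs]; infer_instance
  have hpart : ∀ N, Measure.sum (fun k : Fin N => ρ k) ≤ μ := by
    intro N
    induction N with
    | zero =>
      rw [Measure.sum_of_isEmpty]
      exact Measure.zero_le μ
    | succ N ih =>
      refine Measure.le_iff.2 fun C hC => ?_
      have hmeas : Measurable fun x => φ x (Prod.mk x ⁻¹' C) :=
        Kernel.measurable_kernel_prodMk_left hC
      have h1 : ∀ k, ρ (k + 1) C = ∫⁻ p, M.opG α (fun x => φ x (Prod.mk x ⁻¹' C)) p ∂(ρ k) := by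
        intro k
        have := hfin k
        rw [hρs, Measure.compProd_apply hC,
          Measure.lintegral_bind (M.jumpKernel α).measurable.aemeasurable hmeas.aemeasurable]
        simp_rw [M.lintegral_jumpKernel α _ hmeas]
      rw [Measure.sum_apply _ hC, tsum_fintype, Fin.sum_univ_succ]
      simp only [Fin.val_zero, Fin.val_succ, h1]
      rw [← tsum_fintype (L := .unconditional _), ← lintegral_sum_measure, hρ0,
        Measure.compProd_apply hC]
      calc _ ≤ (∫⁻ x, φ x (Prod.mk x ⁻¹' C) ∂ν₀) +
            ∫⁻ p, M.opG α (fun x => φ x (Prod.mk x ⁻¹' C)) p ∂μ := by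
            gcongr
        _ = μ C := by
            conv_rhs => rw [← hdis, Measure.compProd_apply hC, hbal, lintegral_add_measure,
              Measure.lintegral_bind (M.jumpKernel α).measurable.aemeasurable hmeas.aemeasurable]
            simp_rw [M.lintegral_jumpKernel α _ hmeas]
  have hsum : Measure.sum ρ ≤ μ := by
    refine Measure.le_iff.2 fun C hC => ?_
    rw [Measure.sum_apply _ hC]
    refine ENNReal.tsum_le_of_sum_range_le fun N => ?_
    have := hpart N C
    rwa [Measure.sum_apply _ hC, tsum_fintype, Fin.sum_univ_eq_sum_range (fun k => ρ k C)] at this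
  refine ⟨ρ, ⟨fun k => ?_, ?_, fun k => ?_⟩, hsum⟩
  · exact nonpos_iff_eq_zero.1
      (((Measure.le_sum ρ k).trans hsum _).trans h.support.le)
  · rw [hρ0]; exact Measure.fst_compProd _ _
  · rw [hρs]; exact Measure.fst_compProd _ _

end Stationary

end PDMPModel

/-! ### Weak lower semicontinuity of integrals -/

/-- A nonnegative lower semicontinuous function on a metrizable space is the supremum of an
increasing sequence of bounded continuous functions. -/
lemma LowerSemicontinuous.exists_monotone_iSup_eq {X : Type*} [TopologicalSpace X]
    [TopologicalSpace.MetrizableSpace X] {g : X → ℝ≥0∞} (hg : LowerSemicontinuous g) :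
    ∃ G : ℕ → X →ᵇ ℝ≥0, (∀ x, Monotone fun j => G j x) ∧ ∀ x, ⨆ j, (G j x : ℝ≥0∞) = g x := by
  let _ := TopologicalSpace.metrizableSpaceMetric X
  -- the largest `j`-Lipschitz minorant of `min g j`
  let F : ℕ → X → ℝ≥0∞ := fun j x => ⨅ y, (min (g y) j + j * edist x y)
  have hFle : ∀ j x, F j x ≤ min (g x) j := fun j x => (iInf_le _ x).trans (by simp)
  have hFtop : ∀ j x, F j x ≠ ∞ := fun j x =>
    (((hFle j x).trans (min_le_right _ _)).trans_lt (ENNReal.natCast_lt_top j)).ne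
  have hFlip : ∀ j x x', F j x ≤ F j x' + j * edist x x' := by
    intro j x x'
    rw [ENNReal.iInf_add]
    refine le_iInf fun y => (iInf_le _ y).trans ?_
    rw [add_assoc, ← mul_add, add_comm (edist x' y)]
    gcongr
    exact edist_triangle _ _ _
  have hlip : ∀ j : ℕ, LipschitzWith (j : ℝ≥0) fun x => (F j x).toNNReal := by
    intro j x x'
    have h1 : ∀ x x', (F j x).toNNReal ≤ (F j x').toNNReal + j * nndist x x' := by
      intro x x'
      rw [← ENNReal.coe_le_coe, ENNReal.coe_add, ENNReal.coe_toNNReal (hFtop j x),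
        ENNReal.coe_toNNReal (hFtop j x'), ENNReal.coe_mul, ← edist_nndist]
      exact_mod_cast hFlip j x x'
    rw [edist_nndist, edist_nndist]
    norm_cast
    rw [← NNReal.coe_le_coe, coe_nndist, NNReal.dist_eq, abs_sub_le_iff]
    have h2 := NNReal.coe_le_coe.2 (h1 x x')
    have h3 := NNReal.coe_le_coe.2 (h1 x' x)
    rw [nndist_comm x' x] at h3
    push_cast at h2 h3 ⊢
    constructor <;> linarith
  have hbd : ∀ j x x', dist (F j x).toNNReal (F j x').toNNReal ≤ j := by
    have h1 : ∀ j x, ((F j x).toNNReal : ℝ) ≤ j := by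
      intro j x
      have := ENNReal.toNNReal_mono (ENNReal.natCast_ne_top j)
        ((hFle j x).trans (min_le_right _ _))
      rw [ENNReal.toNNReal_natCast] at this
      exact_mod_cast this
    intro j x x'
    rw [NNReal.dist_eq, abs_sub_le_iff]
    constructor <;> linarith [h1 j x, h1 j x', NNReal.coe_nonneg (F j x).toNNReal,
      NNReal.coe_nonneg (F j x').toNNReal]
  refine ⟨fun j => BoundedContinuousFunction.mkOfBound ⟨_, (hlip j).continuous⟩ j (hbd j),
    fun x i j hij => ?_, fun x => ?_⟩
  · refine ENNReal.toNNReal_mono (hFtop j x) (iInf_mono fun y => ?_)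
    gcongr
  · change ⨆ j, ((F j x).toNNReal : ℝ≥0∞) = g x
    simp_rw [ENNReal.coe_toNNReal (hFtop _ x)]
    refine le_antisymm (iSup_le fun j => (hFle j x).trans (min_le_left _ _)) ?_
    refine le_of_forall_lt fun c hc => ?_
    obtain ⟨c', hcc', hc'⟩ := exists_between hc
    obtain ⟨r, hr, hball⟩ := EMetric.mem_nhds_iff.1 (hg x c' hc')
    have hc't : c' ≠ ∞ := hc'.ne_top
    obtain ⟨j, hj⟩ := ENNReal.exists_nat_gt (r := max c' (c' / r))
      (max_lt hc't.lt_top (ENNReal.div_lt_top hc't hr.ne')).ne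
    refine hcc'.trans_le (le_iSup_of_le j (le_iInf fun y => ?_))
    by_cases hy : edist x y < r
    · refine le_add_right (le_min ?_ ((le_max_left _ _).trans hj.le))
      exact le_of_lt (hball (by rwa [Metric.mem_eball, edist_comm]))
    · refine le_add_left ?_
      calc c' ≤ j * r := by
            rw [← ENNReal.div_le_iff_le_mul (Or.inl hr.ne') (Or.inr (zero_le.trans_lt hj).ne')]
            exact (le_max_right _ _).trans hj.le
        _ ≤ j * edist x y := by gcongr; exact not_lt.1 hy

/-- Integrals of nonnegative lower semicontinuous functions are lower semicontinuous for the weak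
convergence of finite measures. -/
lemma MeasureTheory.FiniteMeasure.lintegral_le_of_tendsto {X ι : Type*} [TopologicalSpace X]
    [TopologicalSpace.MetrizableSpace X] [MeasurableSpace X] [BorelSpace X] {L : Filter ι} [L.NeBot]
    {σs : ι → FiniteMeasure X} {σ : FiniteMeasure X} (h : Tendsto σs L (𝓝 σ)) {g : X → ℝ≥0∞}
    (hg : LowerSemicontinuous g) {c : ℝ≥0∞}
    (hc : Tendsto (fun n => ∫⁻ x, g x ∂(σs n : Measure X)) L (𝓝 c)) :
    ∫⁻ x, g x ∂(σ : Measure X) ≤ c := by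
  obtain ⟨G, hmono, hsup⟩ := hg.exists_monotone_iSup_eq
  simp_rw [← hsup]
  rw [lintegral_iSup (fun j => (G j).continuous.measurable.coe_nnreal_ennreal)
    (fun i j hij x => ENNReal.coe_le_coe.2 (hmono x hij))]
  refine iSup_le fun j => ?_
  refine le_of_tendsto_of_tendsto' (FiniteMeasure.tendsto_iff_forall_lintegral_tendsto.1 h (G j))
    hc fun n => lintegral_mono fun x => ?_
  rw [← hsup]
  exact le_iSup (fun j => (G j x : ℝ≥0∞)) j

/-! ### Compactness -/

/-- The part of the graph of an upper hemicontinuous compact-valued multifunction that lies over a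
compact set is compact. -/
lemma UpperHemicontinuous.isCompact_graph {X Y : Type*} [TopologicalSpace X] [TopologicalSpace Y]
    {F : X → Set Y} (hF : UpperHemicontinuous F) (hcomp : ∀ x, IsCompact (F x)) {C : Set X}
    (hC : IsCompact C) : IsCompact {q : X × Y | q.1 ∈ C ∧ q.2 ∈ F q.1} := by
  rw [isCompact_iff_ultrafilter_le_nhds']
  intro 𝒰 h𝒰
  have hfst : C ∈ 𝒰.map Prod.fst := Ultrafilter.mem_map.2 (by
    filter_upwards [h𝒰] with q hq using hq.1)
  obtain ⟨x, hxC, hx⟩ := hC.ultrafilter_le_nhds' _ hfst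
  suffices h : ∃ y ∈ F x, (𝒰.map Prod.snd : Filter Y) ≤ 𝓝 y by
    obtain ⟨y, hy, hle⟩ := h
    refine ⟨(x, y), ⟨hxC, hy⟩, ?_⟩
    rw [nhds_prod_eq]
    exact le_prod.2 ⟨hx, hle⟩
  by_contra! hno
  have hV : ∀ y ∈ F x, ∃ W, IsOpen W ∧ y ∈ W ∧ W ∉ 𝒰.map Prod.snd := by
    intro y hy
    obtain ⟨W, hW, hWn⟩ := Filter.not_le.1 (hno y hy)
    obtain ⟨W', hW', ho, hyW⟩ := mem_nhds_iff.1 hW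
    exact ⟨W', ho, hyW, fun h => hWn (mem_of_superset h hW')⟩
  choose! W hWo hyW hWn using hV
  obtain ⟨t, htF, htW⟩ := (hcomp x).elim_nhds_subcover W fun y hy => (hWo y hy).mem_nhds (hyW y hy)
  have hev := hF.forall_isOpen x (⋃ y ∈ t, W y)
    (isOpen_biUnion fun y hy => hWo y (htF y hy)) htW
  have hmem : (⋃ y ∈ t, W y) ∈ 𝒰.map Prod.snd := by
    refine Ultrafilter.mem_map.2 ?_
    have hx' : ∀ᶠ q in (𝒰 : Filter (X × Y)), F q.1 ⊆ ⋃ y ∈ t, W y := hx hev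
    filter_upwards [hx', h𝒰] with q hq1 hq2 using hq1 hq2.2
  obtain ⟨y, hy, hyU⟩ := (Ultrafilter.finite_biUnion_mem_iff t.finite_toSet).1 hmem
  exact hWn y (htF y hy) hyU

namespace PDMPModel

variable {m n : ℕ} {U V : Type*} [MeasurableSpace U] [MeasurableSpace V] {M : PDMPModel m U V}

variable {α : ℝ}

lemma opGReal_of_nonneg {h : M.E → ℝ} (h0 : ∀ y, 0 ≤ h y) (p : M.E × U × U) :
    M.opGReal α h p = (M.opG α (fun y => ENNReal.ofReal (h y)) p).toReal := by
  have : (fun y => ENNReal.ofReal (-h y)) = fun _ => 0 := by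
    ext y; exact ENNReal.ofReal_of_nonpos (by linarith [h0 y])
  rw [opGReal, this]
  simp [opG]

lemma RateBounds.opG_le (hr : M.RateBounds) {h : M.E → ℝ≥0∞} (hh : Measurable h) {C : ℝ≥0}
    (hC : ∀ y, h y ≤ C) (p : M.E × U × U) : M.opG α h p ≤ C := by
  rw [← M.lintegral_jumpKernel α p hh]
  calc _ ≤ ∫⁻ _, C ∂(M.jumpKernel α p) := lintegral_mono hC
    _ = C * M.jumpKernel α p univ := lintegral_const _
    _ ≤ C * 1 := by gcongr; exact hr.jumpKernel_univ_le α p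
    _ = C := mul_one _

section Topology

variable [TopologicalSpace U]

lemma isCompact_setOf_fst_mem (hcompact : ∀ x, IsCompact (M.S x)) (husc : UpperHemicontinuous M.S)
    {C : Set M.E} (hC : IsCompact C) : IsCompact {p : M.K | p.1.1 ∈ C} := by
  rw [Subtype.isCompact_iff]
  convert husc.isCompact_graph hcompact hC using 1
  ext q
  constructor
  · rintro ⟨p, hp, rfl⟩; exact ⟨hp, p.2⟩
  · rintro ⟨h1, h2⟩; exact ⟨⟨q, h2⟩, h1, rfl⟩

/-- Weak continuity of `G` makes the measures `G(p; ·)` uniformly tight when `p` ranges over a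
compact part of `𝒦`. -/
lemma WeaklyContinuousG.exists_jumpKernel_compl_le (hG : M.WeaklyContinuousG α)
    (hr : M.RateBounds) (hcompact : ∀ x, IsCompact (M.S x)) (husc : UpperHemicontinuous M.S)
    (Kx : CompactExhaustion M.E) {C : Set M.E} (hC : IsCompact C) {ε : ℝ≥0∞} (hε : 0 < ε) :
    ∃ j, ∀ p ∈ M.K, p.1 ∈ C → M.jumpKernel α p (Kx j)ᶜ ≤ ε := by
  have := M.isOpen_E.locallyCompactSpace
  -- continuous functions that vanish on one compact set and equal `1` outside of the next one
  have hex : ∀ j, ∃ h : M.E →ᵇ ℝ, EqOn h 0 (Kx j) ∧ EqOn h 1 (Kx (j + 1))ᶜ ∧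
      ∀ x, h x ∈ Icc (0 : ℝ) 1 := by
    intro j
    obtain ⟨h, h0, h1, h01⟩ := exists_continuous_zero_one_of_isCompact (Kx.isCompact j)
      (isOpen_interior (s := Kx (j + 1))).isClosed_compl
      (disjoint_compl_right_iff_subset.2 (Kx.subset_interior (Nat.lt_succ_self j)))
    refine ⟨BoundedContinuousFunction.mkOfBound h 1 fun x y => ?_, h0,
      h1.mono (compl_subset_compl.2 interior_subset), h01⟩
    rw [Real.dist_eq, abs_sub_le_iff]
    constructor <;> linarith [(h01 x).1, (h01 x).2, (h01 y).1, (h01 y).2]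
  choose h h0 h1 h01 using hex
  have hmeas : ∀ j, Measurable fun y => ENNReal.ofReal (h j y) := fun j =>
    (h j).continuous.measurable.ennreal_ofReal
  have hopG : ∀ j p, ENNReal.ofReal (M.opGReal α (h j) p) =
      ∫⁻ y, ENNReal.ofReal (h j y) ∂(M.jumpKernel α p) := by
    intro j p
    rw [M.lintegral_jumpKernel α p (hmeas j), opGReal_of_nonneg (fun y => (h01 j y).1),
      ENNReal.ofReal_toReal]
    refine ((hr.opG_le (C := 1) (hmeas j) (fun y => ?_) p).trans_lt ENNReal.coe_lt_top).ne
    simpa using (h01 j y).2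
  have hlow : ∀ j p, M.jumpKernel α p (Kx (j + 1))ᶜ ≤ ENNReal.ofReal (M.opGReal α (h j) p) := by
    intro j p
    rw [hopG, ← lintegral_indicator_one (Kx.isCompact (j + 1)).measurableSet.compl]
    refine lintegral_mono fun y => ?_
    by_cases hy : y ∈ (Kx (j + 1))ᶜ
    · rw [indicator_of_mem hy, h1 j hy]; simp
    · rw [indicator_of_notMem hy]; exact zero_le
  have hup : ∀ j p, ENNReal.ofReal (M.opGReal α (h j) p) ≤ M.jumpKernel α p (Kx j)ᶜ := by
    intro j p
    rw [hopG, ← lintegral_indicator_one (Kx.isCompact j).measurableSet.compl]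
    refine lintegral_mono fun y => ?_
    by_cases hy : y ∈ (Kx j)ᶜ
    · rw [indicator_of_mem hy]; simpa using (h01 j y).2
    · rw [indicator_of_notMem hy, h0 j (not_not.1 hy)]; simp
  have hanti : ∀ p, Antitone fun j => ENNReal.ofReal (M.opGReal α (h j) p) := fun p =>
    antitone_nat_of_succ_le fun j => (hup (j + 1) p).trans (hlow j p)
  obtain ⟨j, hj⟩ := (isCompact_setOf_fst_mem hcompact husc hC).elim_directed_cover
    (fun j => {p : M.K | ENNReal.ofReal (M.opGReal α (h j) p) < ε})
    (fun j => by
      have hc : Continuous fun p : M.K => M.opGReal α (h j) p :=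
        continuousOn_iff_continuous_domRestrict.1 (hG (h j)).1
      exact isOpen_lt (ENNReal.continuous_ofReal.comp hc) continuous_const)
    (fun p _ => by
      have hlim : Tendsto (fun j => M.jumpKernel α p (Kx j)ᶜ) atTop (𝓝 0) := by
        have := hr.isFiniteKernel α
        have h2 := tendsto_measure_iInter_atTop (μ := M.jumpKernel α p) (s := fun j => (Kx j)ᶜ)
          (fun j => (Kx.isCompact j).measurableSet.compl.nullMeasurableSet)
          (fun i j hij => compl_subset_compl.2 (Kx.subset hij)) ⟨0, measure_ne_top _ _⟩
        rwa [← compl_iUnion, Kx.iUnion_eq, compl_univ, measure_empty] at h2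
      obtain ⟨j, hj⟩ := ((tendsto_order.1 hlim).2 ε hε).exists
      exact mem_iUnion.2 ⟨j, (hup j p).trans_lt hj⟩)
    (directed_of_isDirected_le fun i j hij p hp => (hanti p hij).trans_lt hp)
  exact ⟨j + 1, fun p hp hpC => (hlow j p).trans (le_of_lt (hj (a := ⟨p, hp⟩) hpC))⟩

/-- The states of index `k` are tight, uniformly over all occupation sequences. -/
lemma exists_forall_isOccupationSequence_compl_le (hG : M.WeaklyContinuousG α)
    (hr : M.RateBounds) (hcompact : ∀ x, IsCompact (M.S x)) (husc : UpperHemicontinuous M.S)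
    (Kx : CompactExhaustion M.E) (ν₀ : Measure M.E) [IsProbabilityMeasure ν₀] (k : ℕ) {ε : ℝ≥0∞}
    (hε : 0 < ε) :
    ∃ j, ∀ ρ, M.IsOccupationSequence α ν₀ ρ → ρ k {p | p.1 ∉ Kx j} ≤ ε := by
  have hset : ∀ j, {p : M.E × U × U | p.1 ∉ Kx j} = Prod.fst ⁻¹' (Kx j)ᶜ := fun j => rfl
  have hm : ∀ j, MeasurableSet (Kx j)ᶜ := fun j => (Kx.isCompact j).measurableSet.compl
  induction k generalizing ε with
  | zero =>
    have h2 := tendsto_measure_iInter_atTop (μ := ν₀) (s := fun j => (Kx j)ᶜ)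
      (fun j => (hm j).nullMeasurableSet)
      (fun i j hij => compl_subset_compl.2 (Kx.subset hij)) ⟨0, measure_ne_top _ _⟩
    rw [← compl_iUnion, Kx.iUnion_eq, compl_univ, measure_empty] at h2
    obtain ⟨j, hj⟩ := ((tendsto_order.1 h2).2 ε hε).exists
    refine ⟨j, fun ρ hρ => ?_⟩
    rw [hset, ← Measure.map_apply measurable_fst (hm j), hρ.map_zero]
    exact hj.le
  | succ k ih =>
    obtain ⟨i, hi⟩ := ih (ENNReal.half_pos hε.ne')
    obtain ⟨j, hj⟩ := hG.exists_jumpKernel_compl_le hr hcompact husc Kx (Kx.isCompact i)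
      (ENNReal.half_pos hε.ne')
    refine ⟨j, fun ρ hρ => ?_⟩
    have hae : ∀ᵐ p ∂(ρ k), p ∈ M.K := hρ.support k
    rw [hset, ← Measure.map_apply measurable_fst (hm j), hρ.map_succ,
      Measure.bind_apply (hm j) (M.jumpKernel α).measurable.aemeasurable]
    have hm' : MeasurableSet {p : M.E × U × U | p.1 ∉ Kx i} := measurable_fst (hm i)
    calc ∫⁻ p, M.jumpKernel α p (Kx j)ᶜ ∂(ρ k)
        ≤ ∫⁻ p, (ε / 2 + {p : M.E × U × U | p.1 ∉ Kx i}.indicator 1 p) ∂(ρ k) := by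
          refine lintegral_mono_ae (hae.mono fun p hp => ?_)
          by_cases hpi : p.1 ∈ Kx i
          · exact le_add_right (hj p hp hpi)
          · rw [indicator_of_mem (by exact hpi)]
            exact le_add_left ((measure_mono (subset_univ _)).trans (hr.jumpKernel_univ_le α p))
      _ = ε / 2 * ρ k univ + ρ k {p : M.E × U × U | p.1 ∉ Kx i} := by
          rw [lintegral_add_left measurable_const, lintegral_const, lintegral_indicator_one hm']
      _ ≤ ε / 2 * 1 + ε / 2 := by
          gcongr
          · exact hρ.univ_le_one hr k
          · exact hi ρ hρ
      _ = ε := by rw [mul_one, ENNReal.add_halves]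

variable [TopologicalSpace.MetrizableSpace U] [SecondCountableTopology U] [BorelSpace U]

/-- Occupation sequences are compact for the weak convergence of their terms, and the integrals of
lower semicontinuous functions against their sums are lower semicontinuous. -/
lemma exists_isOccupationSequence_limit (hG : M.WeaklyContinuousG α)
    (hr : M.RateBounds) (hK : MeasurableSet M.K) (hcompact : ∀ x, IsCompact (M.S x))
    (husc : UpperHemicontinuous M.S) {ν₀ : Measure M.E} [IsProbabilityMeasure ν₀] {ι : Type*}
    (𝒰 : Ultrafilter ι) {ρ : ι → ℕ → Measure (M.E × U × U)}
    (hρ : ∀ i, M.IsOccupationSequence α ν₀ (ρ i)) :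
    ∃ ρ' : ℕ → Measure (M.E × U × U), M.IsOccupationSequence α ν₀ ρ' ∧
      ∀ g : M.E × U × U → ℝ≥0∞, LowerSemicontinuousOn g M.K → ∀ (B : ι → ℝ≥0∞) (b : ℝ≥0∞),
        Tendsto B 𝒰 (𝓝 b) → (∀ i, ∫⁻ p, g p ∂(Measure.sum (ρ i)) ≤ B i) →
        ∫⁻ p, g p ∂(Measure.sum ρ') ≤ b := by
  have := M.isOpen_E.locallyCompactSpace
  have hemb : MeasurableEmbedding (Subtype.val : M.K → M.E × U × U) :=
    MeasurableEmbedding.subtype_coe hK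
  let Kx : CompactExhaustion M.E := CompactExhaustion.choice M.E
  -- transfer to finite measures on the metrizable space `𝒦`
  have hmass : ∀ i k, (ρ i k).comap (Subtype.val : M.K → _) univ ≤ 1 := by
    intro i k
    rw [hemb.comap_apply]
    exact (measure_mono (subset_univ _)).trans ((hρ i).univ_le_one hr k)
  let σs : ι → ℕ → FiniteMeasure M.K := fun i k =>
    ⟨(ρ i k).comap Subtype.val, ⟨(hmass i k).trans_lt ENNReal.one_lt_top⟩⟩
  have hσs : ∀ i k, ((σs i k : FiniteMeasure M.K) : Measure M.K).map Subtype.val = ρ i k := by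
    intro i k
    change ((ρ i k).comap Subtype.val).map Subtype.val = _
    rw [hemb.map_comap, Subtype.range_coe]
    exact Measure.restrict_eq_self_of_ae_mem ((hρ i).support k)
  have hlim : ∀ k, ∃ σ : FiniteMeasure M.K, Tendsto (fun i => σs i k) 𝒰 (𝓝 σ) := by
    intro k
    obtain ⟨u, -, hu0, hu⟩ := exists_seq_strictAnti_tendsto (0 : ℝ≥0)
    choose j hj using fun N => exists_forall_isOccupationSequence_compl_le hG hr hcompact husc Kx
      ν₀ k (ε := u N) (by exact_mod_cast hu0 N)
    have hcpt := isCompact_setOfPred_finiteMeasure_mass_le_compl_isCompact_le (E := M.K) 1 hu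
      (fun N => isCompact_setOf_fst_mem hcompact husc (Kx.isCompact (j N))) (Or.inl inferInstance)
    obtain ⟨σ, -, hσ⟩ := hcpt.ultrafilter_le_nhds' (𝒰.map fun i => σs i k)
      (by
        refine Ultrafilter.mem_map.2 (Eventually.of_forall fun i => ⟨?_, fun N => ?_⟩)
        · rw [← ENNReal.coe_le_coe, FiniteMeasure.ennreal_mass]
          exact hmass i k
        · rw [← ENNReal.coe_le_coe, FiniteMeasure.ennreal_coeFn_eq_coeFn_toMeasure]
          change (ρ i k).comap Subtype.val _ ≤ _
          rw [hemb.comap_apply]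
          refine (measure_mono ?_).trans (hj N (ρ i) (hρ i))
          rintro _ ⟨p, hp, rfl⟩
          exact hp)
    exact ⟨σ, hσ⟩
  choose σ hσ using hlim
  have hint : ∀ (τ : FiniteMeasure M.K) (g : M.E × U × U → ℝ≥0∞),
      ∫⁻ p, g p ∂((τ : Measure M.K).map Subtype.val) = ∫⁻ p : M.K, g p ∂(τ : Measure M.K) :=
    fun τ g => hemb.lintegral_map g
  have hintρ : ∀ i k (g : M.E × U × U → ℝ≥0∞),
      ∫⁻ p, g p ∂(ρ i k) = ∫⁻ p : M.K, g p ∂(σs i k : Measure M.K) := by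
    intro i k g
    rw [← hint, hσs]
  -- convergence of the integrals of bounded continuous functions of the state
  have hfst : ∀ k (h : M.E →ᵇ ℝ≥0), Tendsto (fun i => ∫⁻ p, h p.1 ∂(ρ i k)) 𝒰
      (𝓝 (∫⁻ p, h p.1 ∂((σ k : Measure M.K).map Subtype.val))) := by
    intro k h
    simp_rw [hintρ, hint _ fun p => (h p.1 : ℝ≥0∞)]
    exact FiniteMeasure.tendsto_iff_forall_lintegral_tendsto.1 (hσ k)
      (h.compContinuous ⟨fun p : M.K => p.1.1, by fun_prop⟩)
  have hmap : ∀ (ν : Measure (M.E × U × U)) (h : M.E →ᵇ ℝ≥0),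
      ∫⁻ y, h y ∂(ν.map Prod.fst) = ∫⁻ p, h p.1 ∂ν := fun ν h =>
    lintegral_map h.continuous.measurable.coe_nnreal_ennreal measurable_fst
  refine ⟨fun k => (σ k : Measure M.K).map Subtype.val, ⟨fun k => ?_, ?_, fun k => ?_⟩, ?_⟩
  · rw [hemb.map_apply]
    convert measure_empty (μ := (σ k : Measure M.K))
    ext p
    simp
  · refine ext_of_forall_lintegral_eq_of_IsFiniteMeasure fun h => ?_
    rw [hmap]
    refine tendsto_nhds_unique (hfst 0 h) (tendsto_const_nhds.congr fun i => ?_)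
    rw [← hmap, (hρ i).map_zero]
  · refine ext_of_forall_lintegral_eq_of_IsFiniteMeasure fun h => ?_
    have hh : Measurable fun y => (h y : ℝ≥0∞) := h.continuous.measurable.coe_nnreal_ennreal
    rw [hmap, Measure.lintegral_bind (M.jumpKernel α).measurable.aemeasurable hh.aemeasurable]
    simp_rw [M.lintegral_jumpKernel α _ hh]
    -- the function `Gh` is bounded and continuous on `𝒦`
    obtain ⟨C, hC⟩ : ∃ C : ℝ≥0, ∀ y, h y ≤ C :=
      ⟨_, BoundedContinuousFunction.NNReal.upper_bound h⟩
    have hGC : ∀ p, M.opG α (fun y => (h y : ℝ≥0∞)) p ≤ C := fun p =>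
      hr.opG_le hh (fun y => by exact_mod_cast hC y) p
    have hGcont : Continuous fun p : M.K => (M.opG α (fun y => (h y : ℝ≥0∞)) p).toNNReal := by
      let h' : M.E →ᵇ ℝ := BoundedContinuousFunction.mkOfBound
        ⟨fun y => (h y : ℝ), by fun_prop⟩ C fun x y => by
          have h1 := NNReal.coe_le_coe.2 (hC x)
          have h2 := NNReal.coe_le_coe.2 (hC y)
          simp only [ContinuousMap.coe_mk, Real.dist_eq, abs_sub_le_iff]
          constructor <;> linarith [NNReal.coe_nonneg (h x), NNReal.coe_nonneg (h y)]
      have h1 : Continuous fun p : M.K => M.opGReal α h' p :=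
        continuousOn_iff_continuous_domRestrict.1 (hG h').1
      rw [NNReal.isEmbedding_coe.continuous_iff]
      convert h1 using 1
      ext p
      rw [opGReal_of_nonneg (h := h') (fun y => NNReal.coe_nonneg (h y))]
      simp only [Function.comp_apply, ENNReal.coe_toNNReal_eq_toReal]
      congr 2
      ext y
      exact (ENNReal.ofReal_coe_nnreal).symm
    have hGint : ∀ p, (((M.opG α (fun y => (h y : ℝ≥0∞)) p).toNNReal : ℝ≥0) : ℝ≥0∞) =
        M.opG α (fun y => (h y : ℝ≥0∞)) p := fun p =>
      ENNReal.coe_toNNReal ((hGC p).trans_lt ENNReal.coe_lt_top).ne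
    have hb : ∀ p q : M.K, dist (M.opG α (fun y => (h y : ℝ≥0∞)) p).toNNReal
        (M.opG α (fun y => (h y : ℝ≥0∞)) q).toNNReal ≤ C := by
      have h1 : ∀ p : M.K, ((M.opG α (fun y => (h y : ℝ≥0∞)) p).toNNReal : ℝ) ≤ C := fun p => by
        rw [NNReal.coe_le_coe, ← ENNReal.coe_le_coe, hGint]; exact hGC p
      intro p q
      rw [NNReal.dist_eq, abs_sub_le_iff]
      constructor <;> linarith [h1 p, h1 q,
        NNReal.coe_nonneg (M.opG α (fun y => (h y : ℝ≥0∞)) p).toNNReal,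
        NNReal.coe_nonneg (M.opG α (fun y => (h y : ℝ≥0∞)) q).toNNReal]
    have h3 := FiniteMeasure.tendsto_iff_forall_lintegral_tendsto.1 (hσ k)
      (BoundedContinuousFunction.mkOfBound ⟨_, hGcont⟩ C hb)
    simp only [BoundedContinuousFunction.mkOfBound_coe, ContinuousMap.coe_mk, hGint] at h3
    refine tendsto_nhds_unique (hfst (k + 1) h) ?_
    rw [hint]
    refine h3.congr fun i => ?_
    rw [← hintρ, (hρ i).lintegral_succ k hh]
  · intro g hg B b hB hle
    have hg' : LowerSemicontinuous fun p : M.K => g p := lowerSemicontinuous_restrict_iff.2 hg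
    -- limits along the ultrafilter of the integrals against each term
    have hex : ∀ k, ∃ c, Tendsto (fun i => ∫⁻ p, g p ∂(ρ i k)) 𝒰 (𝓝 c) := fun k =>
      ⟨_, Ultrafilter.le_nhds_lim (𝒰.map fun i => ∫⁻ p, g p ∂(ρ i k))⟩
    choose c hc using hex
    have hgc : ∀ k, ∫⁻ p, g p ∂((σ k : Measure M.K).map Subtype.val) ≤ c k := by
      intro k
      rw [hint]
      refine FiniteMeasure.lintegral_le_of_tendsto (hσ k) hg' ?_
      simpa only [hintρ] using hc k
    rw [lintegral_sum_measure]
    refine ENNReal.tsum_le_of_sum_range_le fun N => (Finset.sum_le_sum fun k _ => hgc k).trans ?_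
    refine le_of_tendsto_of_tendsto' (tendsto_finsetSum _ fun k _ => hc k) hB fun i => ?_
    refine le_trans ?_ (hle i)
    rw [lintegral_sum_measure]
    exact ENNReal.sum_le_tsum _

end Topology

end PDMPModel

namespace PDMPModel

variable {m n : ℕ} {U V : Type*} [MeasurableSpace U] [MeasurableSpace V] {M : PDMPModel m U V}

/-! ### The cost of a sojourn -/

open Classical in
variable (M) in
/-- The discounted cost, seen from its beginning, of a sojourn of length `s ≤ t_*`: the running
cost, and the boundary cost if the sojourn ends at the boundary. -/
noncomputable def sojournCost (α : ℝ) (f r : EuclideanSpace ℝ (Fin m) → U → ℝ≥0)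
    (q : (M.E × U × U) × ℝ≥0∞) : ℝ≥0∞ :=
  (∫⁻ t in timesBefore (min q.2 (M.exitTime q.1.1)),
    expNeg (ENNReal.ofReal α * ENNReal.ofReal t) * f (M.flow q.1.1 t) q.1.2.1) +
  if q.2 = M.exitTime q.1.1 then
    expNeg (ENNReal.ofReal α * q.2) * r (M.exitPoint q.1.1) q.1.2.2 else 0

variable {α : ℝ} {f r : EuclideanSpace ℝ (Fin m) → U → ℝ≥0}

lemma measurable_runningCost_preExit (hf : Measurable fun p : M.E × U => f p.1 p.2) :
    Measurable fun q : M.preExit =>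
      expNeg (ENNReal.ofReal α * ENNReal.ofReal q.1.2) *
        (f (M.flow q.1.1.1 q.1.2) q.1.1.2.1 : ℝ≥0∞) :=
  (measurable_expNeg.comp (by fun_prop)).mul
    (hf.comp M.measurable_preExitAction).coe_nnreal_ennreal

lemma measurable_boundaryCost (hr : Measurable fun p : frontier M.E × U => r p.1 p.2) :
    Measurable fun p : M.E × U × U => (r (M.exitPoint p.1) p.2.2 : ℝ≥0∞) :=
  (hr.comp (f := fun p : M.E × U × U =>
    ((⟨M.exitPoint p.1, M.exitPoint_mem_frontier p.1.2⟩ : frontier M.E), p.2.2))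
    ((Measurable.subtype_mk (M.measurable_exitPoint.comp (by fun_prop))).prodMk
      (by fun_prop))).coe_nnreal_ennreal

lemma lintegral_timesBefore_min (g : ℝ → ℝ≥0∞) (s τ : ℝ≥0∞) :
    ∫⁻ t in timesBefore (min s τ), g t =
      ∫⁻ t, (timesBefore τ).indicator g t * (Iio s).indicator 1 (ENNReal.ofReal t) := by
  rw [← lintegral_indicator (measurableSet_timesBefore _)]
  congr 1
  ext t
  by_cases h1 : t ∈ timesBefore τ
  · by_cases h2 : ENNReal.ofReal t < s
    · have h3 : t ∈ timesBefore (min s τ) := ⟨h1.1, lt_min h2 h1.2⟩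
      rw [indicator_of_mem h3, indicator_of_mem h1, indicator_of_mem (by exact h2)]
      simp
    · have h3 : t ∉ timesBefore (min s τ) := fun h => h2 (h.2.trans_le (min_le_left _ _))
      rw [indicator_of_notMem h3, indicator_of_notMem (s := Iio s) (by exact h2), mul_zero]
  · have h3 : t ∉ timesBefore (min s τ) := fun h => h1 (timesBefore_mono (min_le_right _ _) h)
    rw [indicator_of_notMem h1, zero_mul, indicator_of_notMem h3]

lemma measurable_sojournCost (hf : Measurable fun p : M.E × U => f p.1 p.2)
    (hr : Measurable fun p : frontier M.E × U => r p.1 p.2) :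
    Measurable (M.sojournCost α f r) := by
  unfold sojournCost
  have h0 : Measurable fun q : (M.E × U × U) × ℝ≥0∞ => M.exitTime q.1.1 :=
    M.measurable_exitTime.comp (measurable_fst.comp measurable_fst)
  refine Measurable.add ?_ (Measurable.ite (measurableSet_eq_fun measurable_snd h0) ?_
    measurable_const)
  · simp_rw [lintegral_timesBefore_min]
    have h1 := M.measurable_indicator_preExit (F := fun q =>
      expNeg (ENNReal.ofReal α * ENNReal.ofReal q.2) * (f (M.flow q.1.1 q.2) q.1.2.1 : ℝ≥0∞))
      (measurable_runningCost_preExit hf)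
    have h2 : Measurable fun z : ((M.E × U × U) × ℝ≥0∞) × ℝ =>
        (Iio z.1.2).indicator (1 : ℝ≥0∞ → ℝ≥0∞) (ENNReal.ofReal z.2) := by
      have : MeasurableSet {z : ((M.E × U × U) × ℝ≥0∞) × ℝ | ENNReal.ofReal z.2 < z.1.2} :=
        measurableSet_lt (by fun_prop) (by fun_prop)
      exact (measurable_const (a := (1 : ℝ≥0∞))).indicator this
    exact ((h1.comp (g := M.preExit.indicator _) (f := fun z : ((M.E × U × U) × ℝ≥0∞) × ℝ =>
      (z.1.1, z.2)) (by fun_prop)).mul h2).lintegral_prod_right' (ν := volume)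
  · exact (measurable_expNeg.comp (by fun_prop)).mul
      ((measurable_boundaryCost hr).comp measurable_fst)

/-- The one-stage cost is the mean cost of a sojourn. -/
lemma RateBounds.stageCost_eq (h : M.RateBounds) (hf : Measurable fun p : M.E × U => f p.1 p.2)
    (p : M.E × U × U) :
    M.stageCost α f r p = ∫⁻ s, M.sojournCost α f r (p, s) ∂(M.sojournLaw p) := by
  classical
  have := h.isProbabilityMeasure_sojournLaw p
  set φ : ℝ → ℝ≥0∞ := fun t =>
    expNeg (ENNReal.ofReal α * ENNReal.ofReal t) * f (M.flow p.1 t) p.2.1 with hφ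
  have hφm : Measurable ((timesBefore (M.exitTime p.1)).indicator φ) :=
    (M.measurable_indicator_preExit (F := fun q =>
      expNeg (ENNReal.ofReal α * ENNReal.ofReal q.2) * (f (M.flow q.1.1 q.2) q.1.2.1 : ℝ≥0∞))
      (measurable_runningCost_preExit hf)).comp (measurable_prodMk_left (x := p))
  have hbm : Measurable fun s : ℝ≥0∞ => if s = M.exitTime p.1 then
      expNeg (ENNReal.ofReal α * s) * (r (M.exitPoint p.1) p.2.2 : ℝ≥0∞) else 0 :=
    Measurable.ite (measurableSet_singleton _)
      ((measurable_expNeg.comp (by fun_prop)).mul measurable_const) measurable_const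
  have hind : Measurable fun z : ℝ≥0∞ × ℝ =>
      (Iio z.1).indicator (1 : ℝ≥0∞ → ℝ≥0∞) (ENNReal.ofReal z.2) := by
    have : MeasurableSet {z : ℝ≥0∞ × ℝ | ENNReal.ofReal z.2 < z.1} :=
      measurableSet_lt (by fun_prop) (by fun_prop)
    exact (measurable_const (a := (1 : ℝ≥0∞))).indicator this
  change _ = ∫⁻ s, ((∫⁻ t in timesBefore (min s (M.exitTime p.1)), φ t) + _) ∂(M.sojournLaw p)
  rw [lintegral_add_right _ hbm, stageCost]
  congr 1
  · simp_rw [lintegral_timesBefore_min]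
    rw [lintegral_lintegral_swap ((hφm.comp measurable_snd).mul hind).aemeasurable, opL,
      ← lintegral_indicator (measurableSet_timesBefore _)]
    congr 1
    ext t
    rw [lintegral_const_mul _ (by exact hind.comp measurable_prodMk_right)]
    by_cases ht : t ∈ timesBefore (M.exitTime p.1)
    · have h1 : ∫⁻ s, (Iio s).indicator (1 : ℝ≥0∞ → ℝ≥0∞) (ENNReal.ofReal t) ∂(M.sojournLaw p) =
          expNeg (M.cumRate p.1 p.2.1 (ENNReal.ofReal t)) := by
        rw [← M.survival_eq_of_lt ht.2, ← h.sojournLaw_Ioi p ht.1,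
          ← lintegral_indicator_one measurableSet_Ioi]
        rfl
      rw [h1, indicator_of_mem ht, indicator_of_mem ht, disc_eq, hφ]
      ring
    · rw [indicator_of_notMem ht, indicator_of_notMem ht, zero_mul]
  · rw [M.lintegral_sojournLaw p hbm, if_pos rfl, opH, disc_eq]
    rw [setLIntegral_congr_fun (g := fun _ => 0) (measurableSet_timesBefore _) fun s hs => by
      rw [if_neg hs.2.ne, mul_zero], lintegral_zero]
    ring

/-! ### Jump times and path costs -/

lemma jumpTime_succ (ω : M.Path) (k : ℕ) :
    M.jumpTime ω (k + 1) = M.jumpTime ω k + (ω k).2 := Finset.sum_range_succ _ _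

lemma jumpTime_mono (ω : M.Path) : Monotone (M.jumpTime ω) :=
  monotone_nat_of_le_succ fun k => by rw [jumpTime_succ]; exact le_self_add

lemma jumpTime_eq_sum_fin (ω : M.Path) (k : ℕ) :
    M.jumpTime ω k = ∑ i : Fin k, (ω i).2 :=
  (Fin.sum_univ_eq_sum_range (fun i => (ω i).2) k).symm

lemma measurable_jumpTime (k : ℕ) : Measurable fun ω : M.Path => M.jumpTime ω k :=
  Finset.measurable_fun_sum _ fun i _ => (measurable_pi_apply i).snd

lemma jumpCount_eq {ω : M.Path} {k : ℕ} {t : ℝ} (h1 : M.jumpTime ω k ≤ ENNReal.ofReal t)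
    (h2 : ENNReal.ofReal t < M.jumpTime ω (k + 1)) : M.jumpCount ω t = k := by
  have : {j : ℕ | M.jumpTime ω (j + 1) ≤ ENNReal.ofReal t} = Finset.range k := by
    ext j
    simp only [mem_ofPred_eq, Finset.coe_range, mem_Iio]
    constructor
    · intro h
      by_contra! hk
      exact (h2.trans_le (M.jumpTime_mono ω (by omega : k + 1 ≤ j + 1))).not_ge h
    · intro h
      exact (M.jumpTime_mono ω (by omega : j + 1 ≤ k)).trans h1
  rw [jumpCount, this, ncard_coe_finset, Finset.card_range]

lemma expNeg_mul_eq_ofReal (hα : 0 ≤ α) {a : ℝ≥0∞} (ha : a ≠ ∞) :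
    expNeg (ENNReal.ofReal α * a) = ENNReal.ofReal (Real.exp (-α * a.toReal)) := by
  rw [← ENNReal.ofReal_toReal ha, ← ENNReal.ofReal_mul hα, expNeg_ofReal (by positivity),
    ENNReal.toReal_ofReal ENNReal.toReal_nonneg, neg_mul]

/-- The cost of a path is at least the sum of the discounted costs of its sojourns. -/
lemma tsum_sojournCost_le_pathCost (hα : 0 < α) (ω : M.Path) :
    ∑' k, expNeg (ENNReal.ofReal α * M.jumpTime ω k) * M.sojournCost α f r ((ω k).1, (ω k).2) ≤
      M.pathCost α f r ω := by
  classical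
  have hzero : expNeg (ENNReal.ofReal α * ∞) = 0 := by
    rw [ENNReal.mul_top (by simpa using hα), expNeg_top]
  simp_rw [sojournCost, mul_add]
  rw [ENNReal.tsum_add]
  refine add_le_add ?_ (ENNReal.tsum_le_tsum fun k => ?_)
  · -- the running costs are integrals over the disjoint intervals between the jumps
    set I : ℕ → Set ℝ := fun k => timesBefore (M.jumpTime ω (k + 1)) \ timesBefore (M.jumpTime ω k)
      with hI
    have hImeas : ∀ k, MeasurableSet (I k) := fun k =>
      (measurableSet_timesBefore _).diff (measurableSet_timesBefore _)
    have hImem : ∀ k t, t ∈ I k → 0 ≤ t ∧ M.jumpTime ω k ≤ ENNReal.ofReal t ∧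
        ENNReal.ofReal t < M.jumpTime ω (k + 1) := fun k t ht =>
      ⟨ht.1.1, not_lt.1 fun h => ht.2 ⟨ht.1.1, h⟩, ht.1.2⟩
    have hdisj : Pairwise (Function.onFun Disjoint I) := by
      intro i j hij
      refine Set.disjoint_left.2 fun t hi hj => hij ?_
      rw [← jumpCount_eq (hImem i t hi).2.1 (hImem i t hi).2.2,
        jumpCount_eq (hImem j t hj).2.1 (hImem j t hj).2.2]
    have hsub : ⋃ k, I k ⊆ timesBefore (M.jumpTimeLim ω) := iUnion_subset fun k =>
      sdiff_subset.trans (timesBefore_mono (le_iSup (M.jumpTime ω) (k + 1)))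
    refine le_trans ?_ (lintegral_mono_set hsub)
    rw [lintegral_iUnion hImeas hdisj]
    refine ENNReal.tsum_le_tsum fun k => ?_
    rcases eq_or_ne (M.jumpTime ω k) ∞ with htop | htop
    · rw [htop, hzero, zero_mul]; exact zero_le
    rw [← lintegral_const_mul' _ _ (expNeg_ne_top _)]
    refine (lintegral_mono_set (timesBefore_mono (min_le_left _ _))).trans ?_
    rw [← lintegral_indicator (hImeas k), ← lintegral_indicator (measurableSet_timesBefore _)]
    refine le_of_le_of_eq ?_
      (lintegral_add_right_eq_self ((I k).indicator _) (M.jumpTime ω k).toReal)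
    refine lintegral_mono fun t => ?_
    by_cases ht : t ∈ timesBefore (ω k).2
    · have hadd : ENNReal.ofReal (t + (M.jumpTime ω k).toReal) =
          ENNReal.ofReal t + M.jumpTime ω k := by
        rw [ENNReal.ofReal_add ht.1 ENNReal.toReal_nonneg, ENNReal.ofReal_toReal htop]
      have h1 : M.jumpTime ω k ≤ ENNReal.ofReal (t + (M.jumpTime ω k).toReal) := by
        rw [hadd]; exact le_add_self
      have h2 : ENNReal.ofReal (t + (M.jumpTime ω k).toReal) < M.jumpTime ω (k + 1) := by
        rw [hadd, jumpTime_succ, add_comm]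
        exact ENNReal.add_lt_add_left htop ht.2
      have hmem : t + (M.jumpTime ω k).toReal ∈ I k :=
        ⟨⟨add_nonneg ht.1 ENNReal.toReal_nonneg, h2⟩, fun h => h.2.not_ge h1⟩
      rw [indicator_of_mem ht, indicator_of_mem hmem, position, jumpCount_eq h1 h2,
        add_sub_cancel_right, ← mul_assoc, ← expNeg_add, ← mul_add, add_comm (M.jumpTime ω k),
        ← hadd, expNeg_mul_eq_ofReal hα.le ENNReal.ofReal_ne_top,
        ENNReal.toReal_ofReal (add_nonneg ht.1 ENNReal.toReal_nonneg)]
    · rw [indicator_of_notMem ht]; exact zero_le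
  · split_ifs with h1 h2 h2
    · have hpos : M.positionBefore ω k = M.exitPoint (ω k).1.1 := by
        have hne : M.exitTime (ω k).1.1 ≠ ∞ := by
          rw [← h1]
          have := h2.1
          rw [jumpTime_succ, ENNReal.add_lt_top] at this
          exact this.2.ne
        rw [positionBefore, exitPoint, if_neg hne, h1]
      rw [← mul_assoc, ← expNeg_add, ← mul_add, ← jumpTime_succ,
        expNeg_mul_eq_ofReal hα.le h2.1.ne, hpos]
    · -- an infinite sojourn is discounted to zero
      have : M.jumpTime ω (k + 1) = ∞ := by
        by_contra hne
        refine h2 ⟨lt_top_iff_ne_top.2 hne, ?_⟩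
        have hS : M.exitTime (ω k).1.1 ≠ ∞ := by
          rw [← h1]
          rw [jumpTime_succ, ENNReal.add_eq_top, not_or] at hne
          exact hne.2
        have hfr := M.exitPoint_mem_frontier (ω k).1.1.2
        rw [exitPoint, if_neg hS, ← h1] at hfr
        exact hfr
      rw [← mul_assoc, ← expNeg_add, ← mul_add, ← jumpTime_succ, this, hzero, zero_mul]
    · rw [mul_zero]; exact zero_le
    · rw [mul_zero]

end PDMPModel

namespace PDMPModel

variable {m n : ℕ} {U V : Type*} [MeasurableSpace U] [MeasurableSpace V] {M : PDMPModel m U V}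

/-! ### The occupation measures of a controlled motion -/

variable (M) in
/-- The information available after the `k`-th jump. -/
def histAfter (k : ℕ) (ω : M.Path) : (Fin k → (M.E × U × U) × ℝ≥0∞) × (M.E × U × U) :=
  (fun i => ω i, (ω k).1)

lemma measurable_histAfter (k : ℕ) : Measurable (M.histAfter k) :=
  (measurable_pi_lambda _ fun _ => measurable_pi_apply _).prodMk (measurable_pi_apply k).fst

variable (M) in
/-- The information available just before the `k + 1`-st jump. -/
def histBefore (k : ℕ) (ω : M.Path) : Fin (k + 1) → (M.E × U × U) × ℝ≥0∞ := fun i => ω i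

lemma measurable_histBefore (k : ℕ) : Measurable (M.histBefore k) :=
  measurable_pi_lambda _ fun _ => measurable_pi_apply _

lemma measurableSet_jumpTime_lt_top (k : ℕ) : MeasurableSet {ω : M.Path | M.jumpTime ω k < ∞} :=
  measurableSet_lt (M.measurable_jumpTime k) measurable_const

variable {α : ℝ} {η : ℕ → Kernel M.E (U × U)} {ν₀ : Measure M.E} {P : Measure M.Path}

/-- Finite measures on `[0, ∞]` that have the same tails are equal. -/
lemma measure_eq_of_Ioi {μ ν : Measure ℝ≥0∞} [IsFiniteMeasure μ] (huniv : μ univ = ν univ)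
    (h : ∀ t : ℝ, 0 ≤ t → μ (Ioi (ENNReal.ofReal t)) = ν (Ioi (ENNReal.ofReal t))) : μ = ν := by
  have : IsFiniteMeasure ν := ⟨by rw [← huniv]; exact measure_lt_top μ _⟩
  refine Measure.ext_of_Iic μ ν fun a => ?_
  rcases eq_or_ne a ∞ with rfl | ha
  · rwa [Iic_top]
  · rw [← compl_Ioi, measure_compl measurableSet_Ioi (measure_ne_top _ _),
      measure_compl measurableSet_Ioi (measure_ne_top _ _), huniv, ← ENNReal.ofReal_toReal ha,
      h _ ENNReal.toReal_nonneg]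

/-- Given the information after the `k`-th jump, the sojourn time has the law `sojournLaw`. -/
lemma IsControlledLaw.lintegral_sojourn (hP : M.IsControlledLaw η ν₀ P) (hr : M.RateBounds) (k : ℕ)
    {g : ((Fin k → (M.E × U × U) × ℝ≥0∞) × (M.E × U × U)) × ℝ≥0∞ → ℝ≥0∞} (hg : Measurable g) :
    ∫⁻ ω in {ω | M.jumpTime ω k < ∞}, g (M.histAfter k ω, (ω k).2) ∂P =
      ∫⁻ ω in {ω | M.jumpTime ω k < ∞},
        ∫⁻ s, g (M.histAfter k ω, s) ∂(M.sojournLaw (ω k).1) ∂P := by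
  have := hP.isProb
  set T : Set M.Path := {ω | M.jumpTime ω k < ∞} with hT
  have hSm : Measurable fun ω : M.Path => (ω k).2 := (measurable_pi_apply k).snd
  have hYm : Measurable fun ω : M.Path => (ω k).1 := (measurable_pi_apply k).fst
  let κ : Kernel ((Fin k → (M.E × U × U) × ℝ≥0∞) × (M.E × U × U)) ℝ≥0∞ :=
    ⟨fun h => M.sojournLaw h.2, M.measurable_sojournLaw.comp measurable_snd⟩
  have hκ : IsMarkovKernel κ := ⟨fun h => hr.isProbabilityMeasure_sojournLaw h.2⟩
  have key : (P.restrict T).map (fun ω => (M.histAfter k ω, (ω k).2)) =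
      ((P.restrict T).map (M.histAfter k)) ⊗ₘ κ := by
    refine Measure.ext_prod fun {s t} hs ht => ?_
    have hA : MeasurableSet (M.histAfter k ⁻¹' s) := measurable_histAfter k hs
    have hAi : MeasurableSet[M.infoAfterJump k] (M.histAfter k ⁻¹' s) := ⟨s, hs, rfl⟩
    have hsl : Measurable fun ω : M.Path => M.sojournLaw (ω k).1 := M.measurable_sojournLaw.comp hYm
    -- for a fixed event of the past, both sides are measures on `[0, ∞]` with the same tails
    have h1 : ((P.restrict (M.histAfter k ⁻¹' s ∩ T)).map fun ω => (ω k).2) =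
        (P.restrict (M.histAfter k ⁻¹' s ∩ T)).bind fun ω => M.sojournLaw (ω k).1 := by
      refine measure_eq_of_Ioi ?_ fun t ht => ?_
      · rw [Measure.map_apply hSm MeasurableSet.univ,
          Measure.bind_apply MeasurableSet.univ hsl.aemeasurable]
        have : ∀ ω : M.Path, M.sojournLaw (ω k).1 univ = 1 := fun ω =>
          (hr.isProbabilityMeasure_sojournLaw (ω k).1).measure_univ
        simp [this]
      · rw [Measure.map_apply hSm measurableSet_Ioi,
          Measure.bind_apply measurableSet_Ioi hsl.aemeasurable,
          Measure.restrict_apply (hSm measurableSet_Ioi), inter_comm]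
        simp_rw [hr.sojournLaw_Ioi _ ht]
        exact hP.sojourn k t ht _ hAi
    rw [Measure.map_apply ((measurable_histAfter k).prodMk hSm) (hs.prod ht),
      Measure.compProd_apply_prod hs ht, setLIntegral_map hs (κ.measurable_coe ht)
        (measurable_histAfter k)]
    have h2 := congrArg (fun ρ : Measure ℝ≥0∞ => ρ t) h1
    rw [Measure.map_apply hSm ht, Measure.bind_apply ht hsl.aemeasurable,
      Measure.restrict_apply (hSm ht)] at h2
    rw [Measure.restrict_restrict hA]
    refine Eq.trans ?_ h2
    rw [Measure.restrict_apply (((measurable_histAfter k).prodMk hSm) (hs.prod ht))]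
    congr 1
    ext ω
    constructor
    · rintro ⟨⟨h3, h4⟩, h5⟩; exact ⟨h4, h3, h5⟩
    · rintro ⟨h4, h3, h5⟩; exact ⟨⟨h3, h4⟩, h5⟩
  rw [← lintegral_map hg ((measurable_histAfter k).prodMk hSm), key,
    Measure.lintegral_compProd hg, lintegral_map hg.lintegral_kernel_prod_right'
      (measurable_histAfter k)]
  rfl

/-- The sojourn times do not outlast the exit times. -/
lemma IsControlledLaw.ae_le_exitTime (hP : M.IsControlledLaw η ν₀ P) (hr : M.RateBounds) (k : ℕ) :
    ∀ᵐ ω ∂(P.restrict {ω | M.jumpTime ω k < ∞}), (ω k).2 ≤ M.exitTime (ω k).1.1 := by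
  let D : Set (((Fin k → (M.E × U × U) × ℝ≥0∞) × (M.E × U × U)) × ℝ≥0∞) :=
    {q | M.exitTime q.1.2.1 < q.2}
  have hD : MeasurableSet D :=
    measurableSet_lt (M.measurable_exitTime.comp (by fun_prop)) measurable_snd
  let F : ((Fin k → (M.E × U × U) × ℝ≥0∞) × (M.E × U × U)) × ℝ≥0∞ → ℝ≥0∞ := D.indicator 1
  have hDm : Measurable F := measurable_one.indicator hD
  have h1 := hP.lintegral_sojourn hr k hDm
  have h2 : ∀ ω : M.Path,
      ∫⁻ s, F (M.histAfter k ω, s) ∂(M.sojournLaw (ω k).1) = 0 := by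
    intro ω
    refine (lintegral_eq_zero_iff (by exact hDm.comp measurable_prodMk_left)).2 ?_
    filter_upwards [M.ae_le_exitTime (ω k).1] with s hs
    exact indicator_of_notMem (by exact hs.not_gt) _
  simp_rw [h2, lintegral_zero] at h1
  have hm : Measurable fun ω : M.Path => (M.histAfter k ω, (ω k).2) :=
    (measurable_histAfter k).prodMk (measurable_pi_apply k).snd
  have h3 := (lintegral_eq_zero_iff (by exact hDm.comp hm)).1 h1
  filter_upwards [h3] with ω hω
  by_contra hnot
  have h4 : (M.histAfter k ω, (ω k).2) ∈ D := not_le.1 hnot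
  have h5 : F (M.histAfter k ω, (ω k).2) = 0 := hω
  exact one_ne_zero ((indicator_of_mem h4 _).symm.trans h5)

/-- Given the information before the `k + 1`-st jump, the location after it has the law
`landing`. -/
lemma IsControlledLaw.lintegral_jump (hP : M.IsControlledLaw η ν₀ P) (hη : M.IsStrategy η)
    (hr : M.RateBounds) (k : ℕ) {B : Set M.E} (hB : MeasurableSet B)
    {g : (Fin (k + 1) → (M.E × U × U) × ℝ≥0∞) → ℝ≥0∞} (hg : Measurable g) :
    ∫⁻ ω in {ω | M.jumpTime ω (k + 1) < ∞} ∩ {ω | (ω (k + 1)).1.1 ∈ B}, g (M.histBefore k ω) ∂P =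
      ∫⁻ ω in {ω | M.jumpTime ω (k + 1) < ∞}, M.landing (ω k) B * g (M.histBefore k ω) ∂P := by
  have := hP.isProb
  set T : Set M.Path := {ω | M.jumpTime ω (k + 1) < ∞} with hT
  have hTm : MeasurableSet T := M.measurableSet_jumpTime_lt_top (k + 1)
  have hD : MeasurableSet {ω : M.Path | (ω (k + 1)).1.1 ∈ B} :=
    (measurable_pi_apply (k + 1)).fst.fst hB
  have hland : Measurable fun ω : M.Path => M.landing (ω k) B :=
    ((Measure.measurable_coe hB).comp M.measurable_landing).comp (measurable_pi_apply k)
  have hsub : T ⊆ {ω | M.jumpTime ω k < ∞} := fun ω hω =>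
    (M.jumpTime_mono ω (Nat.le_succ k)).trans_lt hω
  have hpost : ∀ᵐ ω ∂(P.restrict T),
      ∫⁻ y, η (k + 1) y {c | ((y, c) : M.E × U × U) ∈ B ×ˢ univ}
        ∂(M.postJump (ω k).1 (ω k).2.toReal) = M.landing (ω k) B := by
    filter_upwards [ae_restrict_of_ae_restrict_of_subset hsub (hP.ae_le_exitTime hr k),
      ae_restrict_mem hTm] with ω hω hωT
    have hfin : (ω k).2 < ∞ := by
      have h1 : M.jumpTime ω (k + 1) < ∞ := hωT
      rw [jumpTime_succ, ENNReal.add_lt_top] at h1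
      exact h1.2
    rw [M.postJump_eq_landing _ hω hfin, ← lintegral_indicator_one hB]
    refine lintegral_congr fun y => ?_
    have := (hη (k + 1)).1
    by_cases hy : y ∈ B
    · simp [hy]
    · simp [hy]
  have key : ((P.restrict (T ∩ {ω : M.Path | (ω (k + 1)).1.1 ∈ B})).map (M.histBefore k)) =
      (((P.restrict T).withDensity fun ω => M.landing (ω k) B).map (M.histBefore k)) := by
    ext s hs
    have hA : MeasurableSet (M.histBefore k ⁻¹' s) := measurable_histBefore k hs
    rw [Measure.map_apply (measurable_histBefore k) hs,
      Measure.map_apply (measurable_histBefore k) hs, withDensity_apply _ hA,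
      Measure.restrict_apply hA]
    have h1 := hP.jump k (B ×ˢ univ) (hB.prod MeasurableSet.univ)
      (M.histBefore k ⁻¹' s) ⟨s, hs, rfl⟩
    rw [Measure.restrict_restrict hA]
    rw [← lintegral_congr_ae (ae_restrict_of_ae_restrict_of_subset inter_subset_right hpost), ← h1,
      inter_assoc]
    congr 3
    ext ω
    simp
  rw [← lintegral_map hg (measurable_histBefore k), key, lintegral_map hg (measurable_histBefore k)]
  exact lintegral_withDensity_eq_lintegral_mul _ hland (hg.comp (measurable_histBefore k))

variable (M) in
/-- The discounted occupation measure of the `k`-th state and actions. -/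
noncomputable def occupation (α : ℝ) (P : Measure M.Path) (k : ℕ) : Measure (M.E × U × U) :=
  (P.withDensity fun ω => expNeg (ENNReal.ofReal α * M.jumpTime ω k)).map fun ω => (ω k).1

lemma measurable_discount (k : ℕ) :
    Measurable fun ω : M.Path => expNeg (ENNReal.ofReal α * M.jumpTime ω k) :=
  measurable_expNeg.comp ((M.measurable_jumpTime k).const_mul _)

/-- Infinite jump times are discounted to zero. -/
lemma lintegral_discount_mul (hα : 0 < α) (k : ℕ) (g : M.Path → ℝ≥0∞) :
    ∫⁻ ω, expNeg (ENNReal.ofReal α * M.jumpTime ω k) * g ω ∂P =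
      ∫⁻ ω in {ω | M.jumpTime ω k < ∞}, expNeg (ENNReal.ofReal α * M.jumpTime ω k) * g ω ∂P := by
  rw [← lintegral_indicator (M.measurableSet_jumpTime_lt_top k)]
  refine lintegral_congr fun ω => ?_
  by_cases h : M.jumpTime ω k < ∞
  · rw [indicator_of_mem (by exact h)]
  · rw [indicator_of_notMem (by exact h), not_lt_top_iff.1 h, ENNReal.mul_top (by simpa using hα),
      expNeg_top, zero_mul]

lemma lintegral_occupation (k : ℕ) {g : M.E × U × U → ℝ≥0∞} (hg : Measurable g) :
    ∫⁻ p, g p ∂(M.occupation α P k) =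
      ∫⁻ ω, expNeg (ENNReal.ofReal α * M.jumpTime ω k) * g (ω k).1 ∂P := by
  have hY : Measurable fun ω : M.Path => (ω k).1 := (measurable_pi_apply k).fst
  rw [occupation, lintegral_map hg hY]
  exact lintegral_withDensity_eq_lintegral_mul _ (measurable_discount k) (hg.comp hY)

/-- Averaging over the sojourn time in the discounted occupation measure. -/
lemma IsControlledLaw.lintegral_occupation_sojourn (hP : M.IsControlledLaw η ν₀ P) (hα : 0 < α)
    (hr : M.RateBounds) (k : ℕ) {c : (M.E × U × U) × ℝ≥0∞ → ℝ≥0∞} (hc : Measurable c) :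
    ∫⁻ p, ∫⁻ s, c (p, s) ∂(M.sojournLaw p) ∂(M.occupation α P k) =
      ∫⁻ ω, expNeg (ENNReal.ofReal α * M.jumpTime ω k) * c (ω k) ∂P := by
  let κ : Kernel (M.E × U × U) ℝ≥0∞ := ⟨M.sojournLaw, M.measurable_sojournLaw⟩
  have hκ : IsMarkovKernel κ := ⟨fun p => hr.isProbabilityMeasure_sojournLaw p⟩
  have hm : Measurable fun p => ∫⁻ s, c (p, s) ∂(M.sojournLaw p) :=
    hc.lintegral_kernel_prod_right' (κ := κ)
  rw [lintegral_occupation k hm]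
  refine (lintegral_discount_mul hα k _).trans (Eq.trans ?_ (lintegral_discount_mul hα k _).symm)
  have hd : Measurable fun h : (Fin k → (M.E × U × U) × ℝ≥0∞) × (M.E × U × U) =>
      expNeg (ENNReal.ofReal α * ∑ i, (h.1 i).2) :=
    measurable_expNeg.comp ((Finset.measurable_fun_sum _ fun i _ =>
      ((measurable_pi_apply i).comp measurable_fst).snd).const_mul _)
  have h1 := hP.lintegral_sojourn hr k (g := fun q =>
    expNeg (ENNReal.ofReal α * ∑ i, (q.1.1 i).2) * c (q.1.2, q.2))
    ((hd.comp measurable_fst).mul (hc.comp (by fun_prop)))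
  have h2 : ∀ ω : M.Path, expNeg (ENNReal.ofReal α * ∑ i, ((M.histAfter k ω).1 i).2) =
      expNeg (ENNReal.ofReal α * M.jumpTime ω k) := fun ω => by rw [jumpTime_eq_sum_fin]; rfl
  simp only [h2] at h1
  refine Eq.trans ?_ h1.symm
  refine lintegral_congr fun ω => ?_
  rw [lintegral_const_mul' _ _ (expNeg_ne_top _)]
  rfl

/-- The occupation measures of a controlled motion form an occupation sequence. -/
lemma IsControlledLaw.isOccupationSequence (hP : M.IsControlledLaw η ν₀ P) (hη : M.IsStrategy η)
    (hK : MeasurableSet M.K) (hα : 0 < α) (hr : M.RateBounds) :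
    M.IsOccupationSequence α ν₀ (M.occupation α P) where
  support k := by
    have hY : Measurable fun ω : M.Path => (ω k).1 := (measurable_pi_apply k).fst
    have hSc : ∀ (j : ℕ) (x : M.E), η j x {c | ((x, c) : M.E × U × U) ∈ M.Kᶜ} = 0 := fun j x =>
      (hη j).2 x
    rw [← lintegral_indicator_one hK.compl,
      lintegral_occupation k (measurable_one.indicator hK.compl),
      lintegral_discount_mul hα]
    have hnull : P ({ω | M.jumpTime ω k < ∞} ∩ {ω | (ω k).1 ∈ M.Kᶜ}) = 0 := by
      cases k with
      | zero =>
        refine measure_mono_null inter_subset_right ?_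
        rw [hP.initial _ hK.compl]
        simp_rw [hSc, lintegral_zero]
      | succ k =>
        have h1 := hP.jump k M.Kᶜ hK.compl univ MeasurableSet.univ
        simp_rw [hSc, lintegral_zero, univ_inter] at h1
        exact h1
    have h2 : ∀ᵐ ω ∂(P.restrict {ω | M.jumpTime ω k < ∞}), (ω k).1 ∈ M.K := by
      have hm : MeasurableSet {ω : M.Path | (ω k).1 ∉ M.K} := hY hK.compl
      rw [ae_iff, Measure.restrict_apply hm, inter_comm]
      exact hnull
    refine (lintegral_congr_ae ?_).trans lintegral_zero
    filter_upwards [h2] with ω hω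
    rw [indicator_of_notMem (not_not.2 hω), mul_zero]
  map_zero := by
    have hY : Measurable fun ω : M.Path => (ω 0).1 := (measurable_pi_apply 0).fst
    ext B hB
    have h1 := hP.initial (B ×ˢ univ) (hB.prod MeasurableSet.univ)
    have h2 : (fun ω : M.Path => expNeg (ENNReal.ofReal α * M.jumpTime ω 0)) = 1 := by
      ext ω; simp [jumpTime]
    rw [occupation, h2, withDensity_one, Measure.map_map measurable_fst hY,
      Measure.map_apply (measurable_fst.comp hY) hB]
    have h3 : (Prod.fst ∘ fun ω : M.Path => (ω 0).1) ⁻¹' B = {ω | (ω 0).1 ∈ B ×ˢ univ} := by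
      ext ω; simp
    rw [h3, h1, ← lintegral_indicator_one hB]
    refine lintegral_congr fun x => ?_
    have := (hη 0).1
    by_cases hx : x ∈ B
    · simp [hx]
    · simp [hx]
  map_succ k := by
    ext B hB
    have hB' : MeasurableSet (Prod.fst ⁻¹' B : Set (M.E × U × U)) := measurable_fst hB
    have hBi : Measurable (B.indicator (1 : M.E → ℝ≥0∞)) := measurable_one.indicator hB
    have hlB : Measurable fun q : (M.E × U × U) × ℝ≥0∞ => M.landing q B :=
      (Measure.measurable_coe hB).comp M.measurable_landing
    have hd : Measurable fun q : (M.E × U × U) × ℝ≥0∞ => expNeg (ENNReal.ofReal α * q.2) :=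
      measurable_expNeg.comp (by fun_prop)
    rw [Measure.map_apply measurable_fst hB, ← lintegral_indicator_one hB',
      lintegral_occupation (k + 1) (measurable_one.indicator hB'),
      Measure.bind_apply hB (M.jumpKernel α).measurable.aemeasurable]
    -- the kernel `G` averages the landing distribution over the sojourn law
    have h1 : ∀ p, M.jumpKernel α p B =
        ∫⁻ s, expNeg (ENNReal.ofReal α * s) * M.landing (p, s) B ∂(M.sojournLaw p) := by
      intro p
      rw [← lintegral_indicator_one hB, M.lintegral_jumpKernel α p hBi,
        M.opG_eq_lintegral_sojournLaw α hBi]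
      simp_rw [lintegral_indicator_one hB]
    simp_rw [h1]
    rw [hP.lintegral_occupation_sojourn hα hr k (c := fun q =>
      expNeg (ENNReal.ofReal α * q.2) * M.landing q B) (hd.mul hlB)]
    have h2 : ∀ ω : M.Path, expNeg (ENNReal.ofReal α * M.jumpTime ω k) *
        (expNeg (ENNReal.ofReal α * (ω k).2) * M.landing (ω k) B) =
        expNeg (ENNReal.ofReal α * M.jumpTime ω (k + 1)) * M.landing (ω k) B := by
      intro ω
      rw [← mul_assoc, ← expNeg_add, ← mul_add, jumpTime_succ]
    simp_rw [h2]
    refine (lintegral_discount_mul hα (k + 1) _).trans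
      (Eq.trans ?_ (lintegral_discount_mul hα (k + 1) fun ω => M.landing (ω k) B).symm)
    have hg : Measurable fun h : Fin (k + 1) → (M.E × U × U) × ℝ≥0∞ =>
        expNeg (ENNReal.ofReal α * ∑ i, (h i).2) :=
      measurable_expNeg.comp ((Finset.measurable_fun_sum _ fun i _ =>
        (measurable_pi_apply i).snd).const_mul _)
    have h3 := hP.lintegral_jump hη hr k hB hg
    have h4 : ∀ ω : M.Path, expNeg (ENNReal.ofReal α * ∑ i, (M.histBefore k ω i).2) =
        expNeg (ENNReal.ofReal α * M.jumpTime ω (k + 1)) := fun ω => by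
      rw [jumpTime_eq_sum_fin]; rfl
    simp only [h4] at h3
    have hD : MeasurableSet {ω : M.Path | (ω (k + 1)).1.1 ∈ B} :=
      (measurable_pi_apply (k + 1)).fst.fst hB
    refine Eq.trans ?_ (h3.trans (lintegral_congr fun ω => mul_comm _ _))
    rw [inter_comm, ← Measure.restrict_restrict hD, ← lintegral_indicator hD]
    refine lintegral_congr fun ω => ?_
    by_cases hω : (ω (k + 1)).1.1 ∈ B
    · rw [indicator_of_mem (by exact hω), indicator_of_mem (by exact hω), Pi.one_apply, mul_one]
    · rw [indicator_of_notMem (by exact hω), indicator_of_notMem (by exact hω), mul_zero]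

/-- The expected cost of a controlled motion is at least the integral of the one-stage cost
against the sum of its occupation measures. -/
lemma IsControlledLaw.lintegral_stageCost_le (hP : M.IsControlledLaw η ν₀ P) (hα : 0 < α)
    (hr : M.RateBounds) {f r : EuclideanSpace ℝ (Fin m) → U → ℝ≥0}
    (hf : Measurable fun p : M.E × U => f p.1 p.2)
    (hrm : Measurable fun p : frontier M.E × U => r p.1 p.2) :
    ∫⁻ p, M.stageCost α f r p ∂(Measure.sum (M.occupation α P)) ≤ M.discountedCost α f r P := by
  have hc := measurable_sojournCost (M := M) (α := α) hf hrm
  rw [lintegral_sum_measure]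
  simp_rw [hr.stageCost_eq hf, hP.lintegral_occupation_sojourn hα hr _ hc]
  have hsum := lintegral_tsum (μ := P)
    (f := fun k ω => expNeg (ENNReal.ofReal α * M.jumpTime ω k) * M.sojournCost α f r (ω k))
    fun k => ((measurable_discount k).mul (hc.comp (measurable_pi_apply k))).aemeasurable
  rw [← hsum]
  exact lintegral_mono fun ω => tsum_sojournCost_le_pathCost hα ω

/-! ### Feasible measures -/

variable {c₀ : ℝ} {f r : Fin (n + 1) → EuclideanSpace ℝ (Fin m) → U → ℝ≥0} {d : Fin n → ℝ}

/-- A finite value of the control problem makes the linear program feasible. -/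
lemma exists_isFeasible [IsProbabilityMeasure ν₀] (hα : 0 < α) (hK : MeasurableSet M.K)
    (hcosts : M.MeasurableCosts f r) (hvalue : M.constrainedValue α f r d ν₀ < ∞)
    (hr : M.RateBounds) (hg : M.GrowthCondition α c₀ (f 0) (r 0)) :
    ∃ μ, M.IsFeasible α c₀ f r d ν₀ μ := by
  simp only [constrainedValue, iInf_lt_iff] at hvalue
  obtain ⟨η, hη, P, hP, hcons, hfin⟩ := hvalue
  have hle : ∀ i, _ ≤ M.discountedCost α (f i) (r i) P := fun i =>
    hP.lintegral_stageCost_le hα hr (hcosts i).1 (hcosts i).2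
  exact ⟨_, (hP.isOccupationSequence hη hK hα hr).isFeasible_sum hα hr hg ((hle 0).trans_lt hfin)
    fun i => (EReal.coe_ennreal_le_coe_ennreal_iff.2 (hle i.succ)).trans (hcons i)⟩

end PDMPModel

/-! ### Solvability of the linear program -/

theorem theorem6p4 {m n : ℕ} {U V : Type*}
    [TopologicalSpace U] [TopologicalSpace.MetrizableSpace U] [SecondCountableTopology U]
    [MeasurableSpace U] [BorelSpace U] [StandardBorelSpace U]
    [TopologicalSpace V] [TopologicalSpace.MetrizableSpace V] [SecondCountableTopology V]
    [MeasurableSpace V] [BorelSpace V] [StandardBorelSpace V]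
    (M : PDMPModel m U V) (α : ℝ) (hα : 0 < α)
    (f r : Fin (n + 1) → EuclideanSpace ℝ (Fin m) → U → ℝ≥0) (d : Fin n → ℝ)
    (ν₀ : Measure M.E) (hν₀ : IsProbabilityMeasure ν₀)
    (c₀ : ℝ) (hc₀ : 0 < c₀)
    (hK : MeasurableSet M.K)
    (hcosts : M.MeasurableCosts f r)
    (hvalue : M.constrainedValue α f r d ν₀ < ∞)
    (hrate : M.RateBounds)
    (hgrowth : M.GrowthCondition α c₀ (f 0) (r 0))
    (hlsc : ∀ i, LowerSemicontinuousOn (M.stageCost α (f i) (r i)) M.K)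
    (hcompact : ∀ x, IsCompact (M.S x))
    (husc : UpperHemicontinuous M.S)
    (hG : M.WeaklyContinuousG α) :
    ∃ μ : Measure (M.E × U × U), M.IsFeasible α c₀ f r d ν₀ μ ∧
      ∀ μ' : Measure (M.E × U × U), M.IsFeasible α c₀ f r d ν₀ μ' →
        ∫⁻ p, M.stageCost α (f 0) (r 0) p ∂μ ≤ ∫⁻ p, M.stageCost α (f 0) (r 0) p ∂μ' := by
  obtain ⟨μ₀, hμ₀⟩ := PDMPModel.exists_isFeasible hα hK hcosts hvalue hrate hgrowth
  let S : Set ℝ≥0∞ :=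
    (fun μ : Measure (M.E × U × U) => ∫⁻ p, M.stageCost α (f 0) (r 0) p ∂μ) ''
      {μ | M.IsFeasible α c₀ f r d ν₀ μ}
  have hS : S.Nonempty := ⟨_, μ₀, hμ₀, rfl⟩
  -- a minimizing sequence, and the occupation sequences below it
  obtain ⟨u, -, hu, huS⟩ := exists_seq_tendsto_sInf hS (OrderBot.bddBelow S)
  choose μ hμ hμu using huS
  choose ρ hρ hρμ using fun k => (hμ k).exists_isOccupationSequence hrate
  obtain ⟨ρ', hρ', hle⟩ := PDMPModel.exists_isOccupationSequence_limit hG hrate hK hcompact husc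
    (hyperfilter ℕ) hρ
  have hopt : ∫⁻ p, M.stageCost α (f 0) (r 0) p ∂(Measure.sum ρ') ≤ sInf S :=
    hle _ (hlsc 0) u _ (hu.mono_left Nat.hyperfilter_le_atTop) fun k =>
      (lintegral_mono' (hρμ k) le_rfl).trans (hμu k).le
  have hfin : sInf S < ∞ :=
    (sInf_le (mem_image_of_mem _ hμ₀)).trans_lt
      ((lintegral_mono fun p => le_add_self).trans_lt hμ₀.weight_lt_top)
  refine ⟨Measure.sum ρ', hρ'.isFeasible_sum hα hrate hgrowth (hopt.trans_lt hfin) fun i => ?_,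
    fun μ' hμ' => hopt.trans (sInf_le ⟨μ', hμ', rfl⟩)⟩
  -- a bound `d i` that some feasible measure satisfies is nonnegative, so `ofReal` loses nothing
  have hd : 0 ≤ d i := by
    exact_mod_cast (EReal.coe_ennreal_nonneg _).trans (hμ₀.constraint i)
  have hofReal : ((ENNReal.ofReal (d i) : ℝ≥0∞) : EReal) = d i := by
    rw [EReal.coe_ennreal_ofReal, max_eq_left hd]
  rw [← hofReal, EReal.coe_ennreal_le_coe_ennreal_iff]
  refine hle _ (hlsc i.succ) (fun _ => ENNReal.ofReal (d i)) _ tendsto_const_nhds fun k =>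
    (lintegral_mono' (hρμ k) le_rfl).trans ?_
  have h := (hμ k).constraint i
  rwa [← hofReal, EReal.coe_ennreal_le_coe_ennreal_iff] at h
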